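/- **Setting.** There are $K$ arms and $N\ge 2$ stochastic experts $\pi_1,\dots,\pi_N$, each a conditional distribution $\pi_i(v\mid x)$ of the arm given the context. In each round nature draws $(x,r_1,\dots,r_K)$ from a fixed distribution, independently of the past, with $r_v\in[0,1]$; the learner selects an expert $k(t)$ from the past, an arm $v\sim\pi_{k(t)}(\cdot\mid x)$ is played, and $y=r_v$ is revealed. Let $\mu_i$ be the mean reward under expert $i$, $\mu^*=\max_i\mu_i$, $\Delta_i=\mu^*-\mu_i$, and let $0=\Delta_{(1)}\le\Delta_{(2)}\le\dots\le\Delta_{(N)}$ be the sorted gaps; assume $\Delta_{(2)}>0$. The regret is $R(T)=\mathbb E\sum_{t=1}^T(\mu^*-\mu_{k(t)})$. For a function $f$ let $D_f(\pi_i\|\pi_j)=\mathbb E[f(\pi_i(V|X)/\pi_j(V|X))]$ with $X$ a context and $V\sim\pi_j(\cdot|X)$ (infinite without absolute continuity). Put $M_{ij}=1+\log(1+D_{f_1}(\pi_i\|\pi_j))$ with $f_1(x)=xe^{x-1}-1$, $M=\max_{i,j} M_{ij}$, $\sigma_{ij}^2=1+D_{f_2}(\pi_i\|\pi_j)$ with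 $f_2(x)=x^2-1$, and $\sigma=\max_{i,j}\sigma_{ij}$. **Algorithm (D-UCB).** The first expert is arbitrary (for example random); for $t\ge2$ (and, in (b), once all groups are non-empty; the choice is arbitrary before that) $k(t+1)$ maximizes an index $U_k(t)$, ties being broken arbitrarily. Write $n_j(t)$ for the number of rounds up to $t$ with expert $j$, and $\rho_{k}(s)=\pi_k(v_s|x_s)/\pi_{k(s)}(v_s|x_s)$. (a) *Clipped estimator.* With $Z_k(t)=\sum_j n_j(t)/M_{kj}$ and $\beta=\beta_k(t)\in(0,2)$ the solution of $\beta/\log(2/\beta)=\sqrt{16\,t\log t}/Z_k(t)$, $$U_k(t)=\frac1{Z_k(t)}\sum_{s\le t}\frac{y_s\,\rho_k(s)}{M_{k k(s)}}\mathbf 1\{\rho_k(s)\le 2\log(2/\beta)M_{kk(s)}\}+\tfrac32\beta .$$ (b) *Median of means.* With $\delta(t)=t^{-2}$, the rounds $1,\dots,t$ are divided into $l(t)=\lfloor 8\log(1/\delta(t))\rfloor$ groups, each containing at least $\lfloor n_i(t)/l(t)\rfloor$ of the rounds with expert $i$, for every $i$; the group of round $s$ may depend on the past of round $s$ and on $k(s)$,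 but not on what is observed in or after round $s$. For group $r$, of size $n(r,t)$, let $W_k(r,t)=\sum_{s\in r}1/\sigma_{kk(s)}$ and $\hat\mu_k^{(r)}(t)=W_k(r,t)^{-1}\sum_{s\in r}y_s\rho_k(s)/\sigma_{kk(s)}$, and let $W_k(t)=\min_r W_k(r,t)/n(r,t)$. Then $$U_k(t)=\operatorname{median}_r\hat\mu_k^{(r)}(t)+\frac1{W_k(t)}\sqrt{\frac{64\log(1/\delta(t))}{t}} .$$ **Claim.** Let $\lambda(\mu)=1+\sum_{k=2}^{N-1}\bigl(1-\Delta_{(k)}^2/\Delta_{(k+1)}^2\bigr)$. There are an absolute constant $C>0$ and, for every $N\ge 2$, a $T_0(N)$ such that for every such problem with $N$ experts and every $T\ge T_0(N)$: (i) if $D_{f_1}(\pi_i\|\pi_j)<\infty$ for all $i,j$, then D-UCB with the clipped estimator satisfies $$R(T)\le C\,\frac{M^2\log^2(6/\Delta_{(2)})\log T}{\Delta_{(2)}}\min\Bigl(\lambda(\mu),\frac1{\Delta_{(2)}}\Bigr);$$ (ii) if $D_{f_2}(\pi_i\|\pi_j)<\infty$ for all $i,j$, then D-UCB with the median of means estimator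 satisfies $$R(T)\le C\,\frac{\sigma^2\log T}{\Delta_{(2)}}\min\Bigl(\lambda(\mu),\frac1{\Delta_{(2)}}\Bigr).$$ -/

import Mathlib

open MeasureTheory ProbabilityTheory Filter

/-- One round of the interaction: the context and the rewards of all `K` arms drawn by nature,
`z.1 = (x, (r₁, …, r_K))`, followed by the arm `z.2 = v` that is played. -/
abbrev BanditRound (𝒳 : Type*) (K : ℕ) : Type _ := (𝒳 × (Fin K → ℝ)) × Fin K

/-- The revealed reward `y = r_v` of a round. -/
def BanditRound.reward {𝒳 : Type*} {K : ℕ} (z : BanditRound 𝒳 K) : ℝ := z.1.2 z.2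

/-- A contextual bandit problem with `K` arms, rewards in `[0, 1]` and `N` stochastic experts:
the law of `(x, r₁, …, r_K)`, and the conditional distributions `π_i(v | x)`. -/
structure ExpertBandit (𝒳 : Type*) [MeasurableSpace 𝒳] (K N : ℕ) where
  nature : Measure (𝒳 × (Fin K → ℝ))
  isProbabilityMeasure_nature : IsProbabilityMeasure nature
  reward_mem : ∀ᵐ z ∂nature, ∀ v, z.2 v ∈ Set.Icc (0 : ℝ) 1
  expert : Fin N → Kernel 𝒳 (Fin K)
  isMarkovKernel_expert : ∀ i, IsMarkovKernel (expert i)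

attribute [instance] ExpertBandit.isProbabilityMeasure_nature
attribute [instance] ExpertBandit.isMarkovKernel_expert

/-- The median of `n ≥ 1` real numbers: the mean of the two middle order statistics (which
coincide when `n` is odd). -/
noncomputable def realMedian {n : ℕ} (x : Fin n → ℝ) : ℝ :=
  if h : 0 < n then
    (x (Tuple.sort x ⟨(n - 1) / 2, by omega⟩) + x (Tuple.sort x ⟨n / 2, by omega⟩)) / 2
  else 0

/-- The importance ratio `p(v | x) / q(v | x)`. -/
noncomputable def importanceRatio {𝒳 : Type*} [MeasurableSpace 𝒳] {K : ℕ}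
    (p q : Kernel 𝒳 (Fin K)) (x : 𝒳) (v : Fin K) : ℝ :=
  (p x).real {v} / (q x).real {v}

open Classical in
/-- The conditional `f`-divergence `D_f(p ‖ q) = E_q[f(p(V|X)/q(V|X))]`, where `X ∼ ν` and
`V ∼ q(· | X)`, for `f` bounded below and of superlinear growth. It is infinite when `p` is not
absolutely continuous with respect to `q`, or when the expectation diverges. -/
noncomputable def condFDiv {𝒳 : Type*} [MeasurableSpace 𝒳] {K : ℕ} (f : ℝ → ℝ)
    (ν : Measure 𝒳) (p q : Kernel 𝒳 (Fin K)) : EReal :=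
  if (∀ᵐ x ∂ν, p x ≪ q x) ∧
      Integrable (fun z : 𝒳 × Fin K => f (importanceRatio p q z.1 z.2)) (ν ⊗ₘ q) then
    ((∫ z, f (importanceRatio p q z.1 z.2) ∂(ν ⊗ₘ q) : ℝ) : EReal)
  else ⊤

namespace ExpertBandit

variable {𝒳 : Type*} [MeasurableSpace 𝒳] {K N : ℕ} (B : ExpertBandit 𝒳 K N)

/-- The law of a round in which expert `i` is followed. -/
noncomputable def roundLaw (i : Fin N) : Measure (BanditRound 𝒳 K) :=
  B.nature ⊗ₘ (B.expert i).comap Prod.fst measurable_fst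

/-- The mean reward `μ_i`. -/
noncomputable def mean (i : Fin N) : ℝ := ∫ z, z.reward ∂(B.roundLaw i)

/-- The optimality gap `Δ_i = μ* - μ_i`. -/
noncomputable def gap (i : Fin N) : ℝ := (⨆ j, B.mean j) - B.mean i

/-- `Δ_(k)`, for `1 ≤ k ≤ N`: the gaps in increasing order. -/
noncomputable def sortedGap (k : ℕ) : ℝ :=
  if h : 1 ≤ k ∧ k ≤ N then B.gap (Tuple.sort B.gap ⟨k - 1, by omega⟩) else 0

/-- `λ(μ) = 1 + ∑_{k=2}^{N-1} (1 - Δ_(k)² / Δ_(k+1)²)`. -/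
noncomputable def gapSum : ℝ :=
  1 + ∑ k ∈ Finset.Icc 2 (N - 1), (1 - B.sortedGap k ^ 2 / B.sortedGap (k + 1) ^ 2)

/-! Divergences between the experts -/

/-- `D_{f₁}(π_i ‖ π_j)` with `f₁(x) = x exp(x - 1) - 1`. -/
noncomputable def expDiv (i j : Fin N) : EReal :=
  condFDiv (fun x => x * Real.exp (x - 1) - 1) (B.nature.map Prod.fst) (B.expert i) (B.expert j)

/-- `M_{ij} = 1 + log(1 + D_{f₁}(π_i ‖ π_j))`, meaningful if the divergence is finite. -/
noncomputable def logDiv (i j : Fin N) : ℝ := 1 + Real.log (1 + (B.expDiv i j).toReal)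

/-- `M = max_{i,j} M_{ij}`. -/
noncomputable def maxLogDiv : ℝ := ⨆ p : Fin N × Fin N, B.logDiv p.1 p.2

/-- The chi-square divergence `D_{f₂}(π_i ‖ π_j)` with `f₂(x) = x² - 1`. -/
noncomputable def chiSqDiv (i j : Fin N) : EReal :=
  condFDiv (fun x => x ^ 2 - 1) (B.nature.map Prod.fst) (B.expert i) (B.expert j)

/-- `σ_{ij}`, where `σ_{ij}² = 1 + D_{f₂}(π_i ‖ π_j)`, meaningful if the divergence is finite. -/
noncomputable def sigma (i j : Fin N) : ℝ := Real.sqrt (1 + (B.chiSqDiv i j).toReal)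

/-- `σ = max_{i,j} σ_{ij}`. -/
noncomputable def maxSigma : ℝ := ⨆ p : Fin N × Fin N, B.sigma p.1 p.2

/-! The interaction protocol. Rounds are numbered `1, 2, …`; `κ t` is the expert selected in
round `t`, and `ξ t` is what happens in that round. -/

/-- `κ` and `ξ` are the experts and the rounds produced by some (possibly randomized) way of
selecting experts: the expert of the next round is determined by the past `ℱ t`, and given the
past the next round has the law of the selected expert. -/
structure IsRun {Ω : Type*} [mΩ : MeasurableSpace Ω] (P : Measure Ω) (ℱ : Filtration ℕ mΩ)
    (κ : ℕ → Ω → Fin N) (ξ : ℕ → Ω → BanditRound 𝒳 K) : Prop where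
  measurable_expert : ∀ t, Measurable[ℱ t] (κ (t + 1))
  measurable_round : ∀ t, Measurable[ℱ (t + 1)] (ξ (t + 1))
  law_round : ∀ t (A : Set Ω), MeasurableSet[ℱ t] A → ∀ (i : Fin N) (S : Set (BanditRound 𝒳 K)),
    MeasurableSet S →
      P (A ∩ κ (t + 1) ⁻¹' {i} ∩ ξ (t + 1) ⁻¹' S) =
        P (A ∩ κ (t + 1) ⁻¹' {i}) * B.roundLaw i S

/-- The expected regret `E[∑_{t=1}^T (μ* - μ_{k(t)})]`. -/
noncomputable def regret {Ω : Type*} [MeasurableSpace Ω] (P : Measure Ω)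
    (κ : ℕ → Ω → Fin N) (T : ℕ) : ℝ :=
  ∫ ω, ∑ t ∈ Finset.Icc 1 T, B.gap (κ t ω) ∂P

/-- The ratio `π_k(v | x) / π_j(v | x)` at the context and the arm of a round. -/
noncomputable def ratio (k j : Fin N) (z : BanditRound 𝒳 K) : ℝ :=
  importanceRatio (B.expert k) (B.expert j) z.1.1 z.2

/-- `n_i(t)`, the number of rounds up to `t` in which expert `i` was selected. -/
def pulls (κ : ℕ → Fin N) (t : ℕ) (i : Fin N) : ℕ :=
  ((Finset.Icc 1 t).filter fun s => κ s = i).card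

/-! The clipped estimator. In this and the next part, `κ` and `ξ` are realizations, and sums
over experts `j` and rounds `s` in which `j` was selected are written as sums over `s`, with
`j = κ s`. -/

/-- `Z_k(t) = ∑_j n_j(t) / M_{kj}`. -/
noncomputable def clippedMass (κ : ℕ → Fin N) (t : ℕ) (k : Fin N) : ℝ :=
  ∑ s ∈ Finset.Icc 1 t, 1 / B.logDiv k (κ s)

/-- `β(t)`: the solution of `β / log(2 / β) = √(16 t log t) / Z_k(t)` in `(0, 2)`, which exists
and is unique for `t ≥ 2`. -/
noncomputable def clippedBeta (κ : ℕ → Fin N) (t : ℕ) (k : Fin N) : ℝ :=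
  Classical.epsilon fun b : ℝ => 0 < b ∧ b < 2 ∧
    b / Real.log (2 / b) = Real.sqrt (16 * t * Real.log t) / B.clippedMass κ t k

open Classical in
/-- The clipped importance sampling estimate of `μ_k` with parameter `ε`. -/
noncomputable def clippedEstimate (κ : ℕ → Fin N) (ξ : ℕ → BanditRound 𝒳 K) (t : ℕ) (ε : ℝ)
    (k : Fin N) : ℝ :=
  1 / B.clippedMass κ t k * ∑ s ∈ Finset.Icc 1 t,
    1 / B.logDiv k (κ s) * (ξ s).reward * B.ratio k (κ s) (ξ s) *
      (if B.ratio k (κ s) (ξ s) ≤ 2 * Real.log (2 / ε) * B.logDiv k (κ s) then 1 else 0)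

/-- The upper confidence bound `U_k(t)` of the clipped estimator, with `ε(t) = β(t)`. -/
noncomputable def clippedIndex (κ : ℕ → Fin N) (ξ : ℕ → BanditRound 𝒳 K) (t : ℕ)
    (k : Fin N) : ℝ :=
  B.clippedEstimate κ ξ t (B.clippedBeta κ t k) k + 3 / 2 * B.clippedBeta κ t k

/-- The experts are selected by D-UCB with the clipped estimator: the expert of round `t + 1`
maximizes `U_k(t)`. Ties are broken in any way. For `t = 1` there is no `β(t)`, and the expert
is arbitrary, as in round `1`. -/
def IsClippedUCB {Ω : Type*} [MeasurableSpace Ω] (P : Measure Ω)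
    (κ : ℕ → Ω → Fin N) (ξ : ℕ → Ω → BanditRound 𝒳 K) : Prop :=
  ∀ᵐ ω ∂P, ∀ t, 2 ≤ t → ∀ j,
    B.clippedIndex (fun s => κ s ω) (fun s => ξ s ω) t j ≤
      B.clippedIndex (fun s => κ s ω) (fun s => ξ s ω) t (κ (t + 1) ω)

/-! The median of means estimator. -/

/-- `δ(t) = 1 / t²`. -/
noncomputable def momDelta (t : ℕ) : ℝ := 1 / (t : ℝ) ^ 2

/-- The number of groups, `l(t) = ⌊8 log(1 / δ(t))⌋`. -/
noncomputable def numGroups (t : ℕ) : ℕ := ⌊8 * Real.log (1 / momDelta t)⌋₊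

/-- The rounds up to `t` that a division `g` puts into group `r`. -/
def group (g : ℕ → ℕ) (t r : ℕ) : Finset ℕ := (Finset.Icc 1 t).filter fun s => g s = r

/-- A rule that divides, for every `t ≥ 2`, the rounds `1, …, t` into the groups
`0, …, l(t) - 1`; round `s` is put into group `G t s`. The group of a round does not depend on
what is observed in or after this round, and each group holds at least `⌊n_i(t) / l(t)⌋` of the
rounds in which expert `i` was selected. -/
structure IsGrouping {Ω : Type*} [mΩ : MeasurableSpace Ω] (ℱ : Filtration ℕ mΩ)
    (κ : ℕ → Ω → Fin N) (G : ℕ → ℕ → Ω → ℕ) : Prop where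
  measurable_group : ∀ t s, Measurable[ℱ s] (G t (s + 1))
  lt_numGroups : ∀ t, 2 ≤ t → ∀ s ∈ Finset.Icc 1 t, ∀ ω, G t s ω < numGroups t
  balanced : ∀ t, 2 ≤ t → ∀ ω, ∀ r < numGroups t, ∀ i,
    pulls (fun s => κ s ω) t i / numGroups t ≤
      ((group (fun s => G t s ω) t r).filter fun s => κ s ω = i).card

/-- `W_k(r, t) = ∑_i n_i(r, t) / σ_{ki}`. -/
noncomputable def groupMass (κ : ℕ → Fin N) (g : ℕ → ℕ) (t r : ℕ) (k : Fin N) : ℝ :=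
  ∑ s ∈ group g t r, 1 / B.sigma k (κ s)

/-- The importance sampling estimate of `μ_k` from group `r`. -/
noncomputable def groupMean (κ : ℕ → Fin N) (ξ : ℕ → BanditRound 𝒳 K) (g : ℕ → ℕ) (t r : ℕ)
    (k : Fin N) : ℝ :=
  1 / B.groupMass κ g t r k * ∑ s ∈ group g t r,
    1 / B.sigma k (κ s) * (ξ s).reward * B.ratio k (κ s) (ξ s)

/-- `W_k(t) = min_r W_k(r, t) / n(r, t)`. -/
noncomputable def momMass (κ : ℕ → Fin N) (g : ℕ → ℕ) (t : ℕ) (k : Fin N) : ℝ :=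
  ⨅ r : Fin (numGroups t), B.groupMass κ g t r k / ((group g t r).card : ℝ)

/-- The upper confidence bound `U_k(t)` of the median of means estimator. -/
noncomputable def momIndex (κ : ℕ → Fin N) (ξ : ℕ → BanditRound 𝒳 K) (g : ℕ → ℕ) (t : ℕ)
    (k : Fin N) : ℝ :=
  realMedian (fun r : Fin (numGroups t) => B.groupMean κ ξ g t r k) +
    1 / B.momMass κ g t k * Real.sqrt (64 * Real.log (1 / momDelta t) / t)

/-- The experts are selected by D-UCB with the median of means estimator: the expert of round
`t + 1` maximizes `U_k(t)`. Ties are broken in any way, and the expert is arbitrary as long as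
`U_k(t)` is undefined, that is, when `t ≤ 1` or some group is empty. -/
def IsMomUCB {Ω : Type*} [MeasurableSpace Ω] (P : Measure Ω) (κ : ℕ → Ω → Fin N)
    (ξ : ℕ → Ω → BanditRound 𝒳 K) (G : ℕ → ℕ → Ω → ℕ) : Prop :=
  ∀ᵐ ω ∂P, ∀ t, 2 ≤ t → (∀ r < numGroups t, (group (fun s => G t s ω) t r).Nonempty) → ∀ j,
    B.momIndex (fun s => κ s ω) (fun s => ξ s ω) (fun s => G t s ω) t j ≤
      B.momIndex (fun s => κ s ω) (fun s => ξ s ω) (fun s => G t s ω) t (κ (t + 1) ω)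

end ExpertBandit

/-! Every round is informative about every expert: reweighted by `π_k / π_j`, a round played with
expert `j` estimates `μ_k`, at a price controlled by the divergence. After `t` rounds all experts
are therefore known to accuracy `√(A / t)`, whichever experts were selected, where `A` is of order
`M² log²(6 / Δ_(2)) log T` or `σ² log T`. An optimistic choice then has gap at most `√(A / t)`,
outside an event of probability `O(N / t²)`. A nonzero gap is at least `Δ_(2)`, so only the `t` with
`√(A / t) ≥ Δ_(2)` cost anything on the good events, and these costs sum to at most `2 A / Δ_(2)`
(`IsRun.regret_le`, `sum_sqrt_div_le`). This is stronger than the claim, as `min(λ(μ), 1 / Δ_(2)) ≥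
1`; the remaining additive constant depends only on `N` and is at most `log T` for `T ≥ T₀(N)`.

For the clipped estimator, accuracy comes from Azuma–Hoeffding. The exponential moment of the ratio
makes the clipping bias at most `ε / 2`. The level `β` is random, since it depends on the past
selections, so the deviations are controlled on the grid `(2 / 3) ^ (m + 1)` and transferred to `β`
because the clipped sum is antitone in the level (`clippedIndex_bounds`).

For the median of means, the groups are filled adaptively and are not independent. With `D_r` the
normalized deviation of group `r`, `n_r` its current size and `b` a bound for the final sizes, the
product of the factors `b - n_r + D_r²` over any set `R` of groups is a supermartingale: the size
term compensates the growth of the square. Markov's inequality makes all groups of `R` bad with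
probability at most `(b / θ) ^ |R|`, as under independence, and a union bound over the sets `R` of
half the groups controls the median (`IsRun.measure_forall_group_le`, `IsRun.measure_badGroups_le`).
-/

/-- If fewer than half of the values lie outside `[a, b]`, then the median lies in `[a, b]`. -/
theorem realMedian_mem_Icc {n : ℕ} (x : Fin n → ℝ) {a b : ℝ} (s : Finset (Fin n))
    (hs : ∀ i, i ∉ s → x i ∈ Set.Icc a b) (hcard : 2 * s.card < n) :
    realMedian x ∈ Set.Icc a b := by
  classical
  have hn : 0 < n := by omega
  have hmono : Monotone (x ∘ Tuple.sort x) := Tuple.monotone_sort x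
  -- Otherwise the lower middle value and all those sorted before it lie in `s`. These are `(n - 1)
  -- / 2 + 1` values, at least half of them.
  have hlow : a ≤ x (Tuple.sort x ⟨(n - 1) / 2, by omega⟩) := by
    by_contra! hlt
    have hsub : (Finset.univ.filter fun i : Fin n => (i : ℕ) < (n - 1) / 2 + 1).map
        (Tuple.sort x).toEmbedding ⊆ s := by
      intro i hi
      rw [Finset.mem_map] at hi
      obtain ⟨j, hj, rfl⟩ := hi
      by_contra hjs
      have h1 := (hs _ hjs).1
      have h2 : (x ∘ Tuple.sort x) j ≤ (x ∘ Tuple.sort x) ⟨(n - 1) / 2, by omega⟩ :=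
        hmono (by
          rw [Fin.le_def]
          have := (Finset.mem_filter.1 hj).2
          simp only
          omega)
      simp only [Function.comp, Equiv.coe_toEmbedding] at h1 h2
      linarith
    have := Finset.card_le_card hsub
    rw [Finset.card_map, Fin.card_filter_val_lt] at this
    omega
  have hupp : x (Tuple.sort x ⟨n / 2, by omega⟩) ≤ b := by
    by_contra! hlt
    have hsub : (Finset.univ.filter fun i : Fin n => ¬ (i : ℕ) < n / 2).map
        (Tuple.sort x).toEmbedding ⊆ s := by
      intro i hi
      rw [Finset.mem_map] at hi
      obtain ⟨j, hj, rfl⟩ := hi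
      by_contra hjs
      have h1 := (hs _ hjs).2
      have h2 : (x ∘ Tuple.sort x) ⟨n / 2, by omega⟩ ≤ (x ∘ Tuple.sort x) j :=
        hmono (by
          rw [Fin.le_def]
          have := (Finset.mem_filter.1 hj).2
          simp only
          omega)
      simp only [Function.comp, Equiv.coe_toEmbedding] at h1 h2
      linarith
    have h3 := Finset.card_le_card hsub
    have h4 := Finset.card_filter_add_card_filter_not (s := Finset.univ)
      (fun i : Fin n => (i : ℕ) < n / 2)
    rw [Finset.card_map] at h3
    rw [Fin.card_filter_val_lt, Finset.card_univ, Fintype.card_fin] at h4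
    omega
  have hmid : x (Tuple.sort x ⟨(n - 1) / 2, by omega⟩) ≤ x (Tuple.sort x ⟨n / 2, by omega⟩) :=
    hmono (by rw [Fin.le_def]; simp only; omega)
  rw [realMedian, dif_pos hn]
  constructor <;> linarith

/-! ### Importance sampling, gaps and divergences -/

namespace ExpertBandit

variable {𝒳 : Type*} [MeasurableSpace 𝒳] {K N : ℕ} (B : ExpertBandit 𝒳 K N)

instance (i : Fin N) : IsProbabilityMeasure (B.roundLaw i) := by
  unfold roundLaw; infer_instance

theorem measurable_reward : Measurable (BanditRound.reward : BanditRound 𝒳 K → ℝ) := by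
  unfold BanditRound.reward
  refine measurable_from_prod_countable_left fun v => ?_
  exact (measurable_pi_apply v).comp measurable_snd

theorem measurable_importanceRatio (p q : Kernel 𝒳 (Fin K)) :
    Measurable fun z : 𝒳 × Fin K => importanceRatio p q z.1 z.2 := by
  refine measurable_from_prod_countable_left fun v => ?_
  unfold importanceRatio Measure.real
  exact ((p.measurable_coe (measurableSet_singleton v)).ennreal_toReal).div
    ((q.measurable_coe (measurableSet_singleton v)).ennreal_toReal)

/-- The context and the arm of a round. -/
def contextArm (z : BanditRound 𝒳 K) : 𝒳 × Fin K := (z.1.1, z.2)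

theorem measurable_contextArm : Measurable (contextArm : BanditRound 𝒳 K → 𝒳 × Fin K) := by
  unfold contextArm; fun_prop

theorem measurable_ratio (k j : Fin N) : Measurable (B.ratio k j) :=
  (measurable_importanceRatio (B.expert k) (B.expert j)).comp measurable_contextArm

theorem ratio_nonneg (k j : Fin N) (z : BanditRound 𝒳 K) : 0 ≤ B.ratio k j z := by
  unfold ratio importanceRatio; positivity

theorem map_contextArm_roundLaw (j : Fin N) :
    (B.roundLaw j).map contextArm = (B.nature.map Prod.fst) ⊗ₘ B.expert j := by
  have := Measure.isProbabilityMeasure_map (μ := B.nature) (measurable_fst.aemeasurable)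
  ext s hs
  rw [Measure.map_apply measurable_contextArm hs, roundLaw,
    Measure.compProd_apply (measurable_contextArm hs), Measure.compProd_apply hs, lintegral_map
    (Kernel.measurable_kernel_prodMk_left hs) measurable_fst]
  rfl

theorem lintegral_roundLaw (j : Fin N) {g : BanditRound 𝒳 K → ENNReal} (hg : Measurable g) :
    ∫⁻ z, g z ∂(B.roundLaw j) = ∫⁻ x, ∑ v, g (x, v) * B.expert j x.1 {v} ∂B.nature := by
  rw [roundLaw, Measure.lintegral_compProd hg]
  simp only [lintegral_fintype, Kernel.comap_apply]

/-- Importance sampling: `π_k(V | X) / π_j(V | X)` is the density of the law of a round under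
expert `k` with respect to the law of a round under expert `j`. -/
theorem roundLaw_eq_withDensity {k j : Fin N}
    (hac : ∀ᵐ x ∂(B.nature.map Prod.fst), B.expert k x ≪ B.expert j x) :
    B.roundLaw k = (B.roundLaw j).withDensity fun z => ENNReal.ofReal (B.ratio k j z) := by
  ext s hs
  have hmeas : Measurable fun z => ENNReal.ofReal (B.ratio k j z) :=
    (B.measurable_ratio k j).ennreal_ofReal
  rw [withDensity_apply _ hs, ← lintegral_indicator hs, B.lintegral_roundLaw j (hmeas.indicator hs),
    ← lintegral_indicator_one hs, B.lintegral_roundLaw k (measurable_one.indicator hs)]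
  refine lintegral_congr_ae ?_
  filter_upwards [ae_of_ae_map measurable_fst.aemeasurable hac] with x hx
  refine Finset.sum_congr rfl fun v _ => ?_
  by_cases hv : (x, v) ∈ s
  · simp only [Set.indicator_of_mem hv, Pi.one_apply, one_mul, ratio, importanceRatio]
    -- Where `π_j(v | x) = 0`, the ratio is `0` by the convention for division, and absolute
    -- continuity gives `π_k(v | x) = 0` too.
    by_cases h0 : B.expert j x.1 {v} = 0
    · simp [h0, hx h0]
    · have hpos : 0 < (B.expert j x.1).real {v} := ENNReal.toReal_pos h0 (measure_ne_top _ _)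
      rw [ENNReal.ofReal_div_of_pos hpos, ofReal_measureReal, ofReal_measureReal,
        ENNReal.div_mul_cancel h0 (measure_ne_top _ _)]
  · simp [Set.indicator_of_notMem hv]

theorem integral_ratio_mul {k j : Fin N}
    (hac : ∀ᵐ x ∂(B.nature.map Prod.fst), B.expert k x ≪ B.expert j x)
    (g : BanditRound 𝒳 K → ℝ) :
    ∫ z, B.ratio k j z * g z ∂(B.roundLaw j) = ∫ z, g z ∂(B.roundLaw k) := by
  rw [B.roundLaw_eq_withDensity hac, integral_withDensity_eq_integral_toReal_smul
    (B.measurable_ratio k j).ennreal_ofReal (by simp)]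
  simp [ENNReal.toReal_ofReal (B.ratio_nonneg k j _)]

theorem integrable_ratio_mul {k j : Fin N}
    (hac : ∀ᵐ x ∂(B.nature.map Prod.fst), B.expert k x ≪ B.expert j x)
    {g : BanditRound 𝒳 K → ℝ} (hg : Integrable g (B.roundLaw k)) :
    Integrable (fun z => B.ratio k j z * g z) (B.roundLaw j) := by
  rw [B.roundLaw_eq_withDensity hac, integrable_withDensity_iff_integrable_smul'
    (B.measurable_ratio k j).ennreal_ofReal (by simp)] at hg
  simpa [ENNReal.toReal_ofReal (B.ratio_nonneg k j _)] using hg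

theorem reward_mem_Icc (j : Fin N) :
    ∀ᵐ z ∂(B.roundLaw j), z.reward ∈ Set.Icc (0 : ℝ) 1 := by
  have hs : MeasurableSet {z : BanditRound 𝒳 K | z.reward ∈ Set.Icc (0 : ℝ) 1} :=
    measurable_reward measurableSet_Icc
  rw [roundLaw, Measure.ae_compProd_iff hs]
  filter_upwards [B.reward_mem] with z hz
  exact Eventually.of_forall fun v => hz v

theorem integrable_reward (j : Fin N) :
    Integrable (fun z => z.reward) (B.roundLaw j) :=
  Integrable.of_mem_Icc 0 1 measurable_reward.aemeasurable (B.reward_mem_Icc j)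

theorem mean_mem_Icc (i : Fin N) : B.mean i ∈ Set.Icc (0 : ℝ) 1 := by
  constructor
  · exact integral_nonneg_of_ae ((B.reward_mem_Icc i).mono fun z hz => hz.1)
  · have := integral_mono_ae (B.integrable_reward i) (integrable_const (1 : ℝ))
      ((B.reward_mem_Icc i).mono fun z hz => hz.2)
    simpa [mean] using this

theorem bddAbove_mean : BddAbove (Set.range B.mean) := (Set.finite_range _).bddAbove

theorem gap_nonneg (i : Fin N) : 0 ≤ B.gap i :=
  sub_nonneg.2 (le_ciSup B.bddAbove_mean i)

theorem gap_le_one (i : Fin N) : B.gap i ≤ 1 := by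
  have : Nonempty (Fin N) := ⟨i⟩
  have h1 : (⨆ j, B.mean j) ≤ 1 := ciSup_le fun j => (B.mean_mem_Icc j).2
  have h2 := (B.mean_mem_Icc i).1
  unfold gap; linarith

theorem exists_gap_eq_zero (hN : 2 ≤ N) : ∃ i, B.gap i = 0 := by
  have : Nonempty (Fin N) := ⟨⟨0, by omega⟩⟩
  obtain ⟨i, hi⟩ := exists_eq_ciSup_of_finite (f := B.mean)
  exact ⟨i, by rw [gap, hi, sub_self]⟩

theorem monotone_gap_sort : Monotone (B.gap ∘ Tuple.sort B.gap) := Tuple.monotone_sort _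

/-- There is no gap strictly between `0` and `Δ_(2)`. This is what turns accuracy below `Δ_(2)` into
zero regret. -/
theorem gap_eq_zero_or_le (hN : 2 ≤ N) (i : Fin N) : B.gap i = 0 ∨ B.sortedGap 2 ≤ B.gap i := by
  obtain ⟨j, rfl⟩ := (Tuple.sort B.gap).surjective i
  by_cases hj : (j : ℕ) = 0
  · left
    obtain ⟨i, hi⟩ := B.exists_gap_eq_zero hN
    obtain ⟨m, rfl⟩ := (Tuple.sort B.gap).surjective i
    have h1 : B.gap (Tuple.sort B.gap j) ≤ B.gap (Tuple.sort B.gap m) :=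
      B.monotone_gap_sort (by rw [Fin.le_def]; omega)
    exact le_antisymm (h1.trans hi.le) (B.gap_nonneg _)
  · right
    rw [sortedGap, dif_pos ⟨by omega, hN⟩]
    exact B.monotone_gap_sort (by rw [Fin.le_def]; simp only; omega)

theorem sortedGap_two_le_one : B.sortedGap 2 ≤ 1 := by
  unfold sortedGap
  split_ifs
  · exact B.gap_le_one _
  · exact zero_le_one

theorem sortedGap_mono {k m : ℕ} (hk : 1 ≤ k) (hkm : k ≤ m) (hm : m ≤ N) :
    B.sortedGap k ≤ B.sortedGap m := by
  rw [sortedGap, sortedGap, dif_pos ⟨hk, hkm.trans hm⟩, dif_pos ⟨hk.trans hkm, hm⟩]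
  exact B.monotone_gap_sort (by rw [Fin.le_def]; simp only; omega)

theorem one_le_gapSum (h : 0 < B.sortedGap 2) : 1 ≤ B.gapSum := by
  rw [gapSum, le_add_iff_nonneg_right]
  refine Finset.sum_nonneg fun k hk => ?_
  rw [Finset.mem_Icc] at hk
  have h1 : B.sortedGap 2 ≤ B.sortedGap k := B.sortedGap_mono (by norm_num) hk.1 (by omega)
  have h2 : B.sortedGap k ≤ B.sortedGap (k + 1) :=
    B.sortedGap_mono (by omega) (by omega) (by omega)
  rw [sub_nonneg]
  exact div_le_one_of_le₀ (pow_le_pow_left₀ (by linarith) h2 2) (by positivity)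

/-- This lets the factor `min(λ(μ), 1 / Δ_(2))` be inserted for free at the end. -/
theorem one_le_min_gapSum (h : 0 < B.sortedGap 2) :
    1 ≤ min B.gapSum (1 / B.sortedGap 2) :=
  le_min (B.one_le_gapSum h) ((one_le_div h).2 B.sortedGap_two_le_one)

/-! Finite divergences -/

variable {B}

theorem integral_of_condFDiv_ne_top {f : ℝ → ℝ} (hf : Measurable f) {k j : Fin N}
    (h : condFDiv f (B.nature.map Prod.fst) (B.expert k) (B.expert j) ≠ ⊤) :
    (∀ᵐ x ∂(B.nature.map Prod.fst), B.expert k x ≪ B.expert j x) ∧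
      Integrable (fun z => f (B.ratio k j z)) (B.roundLaw j) ∧
      (condFDiv f (B.nature.map Prod.fst) (B.expert k) (B.expert j)).toReal =
        ∫ z, f (B.ratio k j z) ∂(B.roundLaw j) := by
  unfold condFDiv at h ⊢
  split_ifs at h ⊢ with hc
  · have hm := hf.comp (measurable_importanceRatio (B.expert k) (B.expert j))
    refine ⟨hc.1, ?_, ?_⟩
    · have h2 := hc.2
      rw [← B.map_contextArm_roundLaw j] at h2
      exact (integrable_map_measure hm.aestronglyMeasurable
        measurable_contextArm.aemeasurable).1 h2
    · rw [EReal.toReal_coe, ← B.map_contextArm_roundLaw j]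
      exact integral_map measurable_contextArm.aemeasurable hm.aestronglyMeasurable
  · exact absurd rfl h

theorem integrable_ratio {k j : Fin N}
    (hac : ∀ᵐ x ∂(B.nature.map Prod.fst), B.expert k x ≪ B.expert j x) :
    Integrable (B.ratio k j) (B.roundLaw j) := by
  simpa using B.integrable_ratio_mul hac (integrable_const (1 : ℝ))

theorem integral_ratio {k j : Fin N}
    (hac : ∀ᵐ x ∂(B.nature.map Prod.fst), B.expert k x ≪ B.expert j x) :
    ∫ z, B.ratio k j z ∂(B.roundLaw j) = 1 := by
  simpa using B.integral_ratio_mul hac (fun _ => (1 : ℝ))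

theorem integrable_reward_mul_ratio {k j : Fin N}
    (hac : ∀ᵐ x ∂(B.nature.map Prod.fst), B.expert k x ≪ B.expert j x) :
    Integrable (fun z => z.reward * B.ratio k j z) (B.roundLaw j) := by
  simpa only [mul_comm] using B.integrable_ratio_mul hac (B.integrable_reward k)

theorem integral_reward_mul_ratio {k j : Fin N}
    (hac : ∀ᵐ x ∂(B.nature.map Prod.fst), B.expert k x ≪ B.expert j x) :
    ∫ z, z.reward * B.ratio k j z ∂(B.roundLaw j) = B.mean k := by
  simpa only [mul_comm, mean] using B.integral_ratio_mul hac (fun z => z.reward)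

/-- The line `2x - 2` is the common tangent of `f₁` and `f₂` at `1`, and the ratio has mean `1`, so
the line integrates to `0`. -/
theorem integral_comp_ratio_nonneg {k j : Fin N} {f : ℝ → ℝ}
    (hac : ∀ᵐ x ∂(B.nature.map Prod.fst), B.expert k x ≪ B.expert j x)
    (hf : Integrable (fun z => f (B.ratio k j z)) (B.roundLaw j))
    (hle : ∀ x, 2 * x - 2 ≤ f x) : 0 ≤ ∫ z, f (B.ratio k j z) ∂(B.roundLaw j) := by
  have h := integral_mono (((integrable_ratio hac).const_mul 2).sub (integrable_const 2)) hf
    (fun z => hle (B.ratio k j z))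
  simp only [Pi.sub_apply] at h
  rw [integral_sub ((integrable_ratio hac).const_mul 2) (integrable_const 2),
    integral_const_mul, integral_ratio hac] at h
  simpa using h

theorem expDiv_spec {k j : Fin N} (h : B.expDiv k j ≠ ⊤) :
    (∀ᵐ x ∂(B.nature.map Prod.fst), B.expert k x ≪ B.expert j x) ∧ 1 ≤ B.logDiv k j ∧
      Integrable (fun z => B.ratio k j z * Real.exp (B.ratio k j z - 1)) (B.roundLaw j) ∧
      ∫ z, B.ratio k j z * Real.exp (B.ratio k j z - 1) ∂(B.roundLaw j) =
        Real.exp (B.logDiv k j - 1) := by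
  obtain ⟨hac, hint, hD⟩ := integral_of_condFDiv_ne_top (by fun_prop) h
  have hnonneg : 0 ≤ (B.expDiv k j).toReal := by
    rw [expDiv, hD]
    -- With `|x|` in place of `x`, the tangent bound holds on all of `ℝ`: `|x| exp(|x| - 1) ≥ x²`
    -- and `x² - 1 ≥ 2x - 2`.
    have hae : (fun z => B.ratio k j z * Real.exp (B.ratio k j z - 1) - 1) = fun z =>
        (fun x : ℝ => |x| * Real.exp (|x| - 1) - 1) (B.ratio k j z) := by
      funext z
      simp only [abs_of_nonneg (B.ratio_nonneg k j z)]
    rw [hae] at hint ⊢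
    refine integral_comp_ratio_nonneg
      (f := fun x => |x| * Real.exp (|x| - 1) - 1) hac hint fun x => ?_
    nlinarith [Real.add_one_le_exp (|x| - 1), abs_nonneg x, le_abs_self x, sq_nonneg (|x| - 1)]
  have hint' : Integrable (fun z => B.ratio k j z * Real.exp (B.ratio k j z - 1))
      (B.roundLaw j) := by
    simpa [Pi.add_def] using hint.add (integrable_const (1 : ℝ))
  refine ⟨hac, ?_, hint', ?_⟩
  · have := Real.log_nonneg (x := 1 + (B.expDiv k j).toReal) (by linarith)
    unfold logDiv; linarith
  · rw [logDiv, add_sub_cancel_left, Real.exp_log (by linarith), expDiv, hD,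
      integral_sub hint' (integrable_const 1)]
    simp

theorem chiSqDiv_spec {k j : Fin N} (h : B.chiSqDiv k j ≠ ⊤) :
    (∀ᵐ x ∂(B.nature.map Prod.fst), B.expert k x ≪ B.expert j x) ∧ 1 ≤ B.sigma k j ∧
      Integrable (fun z => B.ratio k j z ^ 2) (B.roundLaw j) ∧
      ∫ z, B.ratio k j z ^ 2 ∂(B.roundLaw j) = B.sigma k j ^ 2 := by
  obtain ⟨hac, hint, hD⟩ := integral_of_condFDiv_ne_top (by fun_prop) h
  have hnonneg : 0 ≤ (B.chiSqDiv k j).toReal := by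
    rw [chiSqDiv, hD]
    refine integral_comp_ratio_nonneg (f := fun x => x ^ 2 - 1) hac hint fun x => ?_
    nlinarith [sq_nonneg (x - 1)]
  have hint' : Integrable (fun z => B.ratio k j z ^ 2) (B.roundLaw j) := by
    simpa [Pi.add_def] using hint.add (integrable_const (1 : ℝ))
  refine ⟨hac, ?_, hint', ?_⟩
  · rw [sigma, Real.one_le_sqrt]; linarith
  · rw [sigma, Real.sq_sqrt (by linarith), chiSqDiv, hD,
      integral_sub hint' (integrable_const 1)]
    simp

theorem logDiv_le_maxLogDiv (k j : Fin N) : B.logDiv k j ≤ B.maxLogDiv :=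
  le_ciSup (f := fun p : Fin N × Fin N => B.logDiv p.1 p.2) (Set.finite_range _).bddAbove (k, j)

theorem sigma_le_maxSigma (k j : Fin N) : B.sigma k j ≤ B.maxSigma :=
  le_ciSup (f := fun p : Fin N × Fin N => B.sigma p.1 p.2) (Set.finite_range _).bddAbove (k, j)

end ExpertBandit

/-! ### Concentration for adaptively selected rounds -/

namespace ExpertBandit

variable {𝒳 : Type*} [MeasurableSpace 𝒳] {K N : ℕ} {B : ExpertBandit 𝒳 K N}

variable {Ω : Type*} [mΩ : MeasurableSpace Ω] {P : Measure Ω}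
  {ℱ : Filtration ℕ mΩ} {κ : ℕ → Ω → Fin N} {ξ : ℕ → Ω → BanditRound 𝒳 K}

/-- Given the past and the selected expert, the next round has the law of this expert. -/
theorem IsRun.setLIntegral_round [IsProbabilityMeasure P] (h : B.IsRun P ℱ κ ξ) (t : ℕ) {α : Type*} [MeasurableSpace α]
    {Y : Ω → α} (hY : Measurable[ℱ t] Y) (i : Fin N) {F : α × BanditRound 𝒳 K → ENNReal}
    (hF : Measurable F) :
    ∫⁻ ω in κ (t + 1) ⁻¹' {i}, F (Y ω, ξ (t + 1) ω) ∂P =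
      ∫⁻ ω in κ (t + 1) ⁻¹' {i}, ∫⁻ z, F (Y ω, z) ∂(B.roundLaw i) ∂P := by
  have hY' : Measurable Y := hY.mono (ℱ.le t) le_rfl
  have hξ : Measurable (ξ (t + 1)) := (h.measurable_round t).mono (ℱ.le _) le_rfl
  -- On the event that `i` is selected, the past and the new round have a product law: `law_round`
  -- says so on rectangles, and these determine the measure.
  have hprod : ((P.restrict (κ (t + 1) ⁻¹' {i})).map Y).prod (B.roundLaw i) =
      (P.restrict (κ (t + 1) ⁻¹' {i})).map fun ω => (Y ω, ξ (t + 1) ω) := by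
    refine Measure.prod_eq fun s S hs hS => ?_
    have e1 : (fun ω => (Y ω, ξ (t + 1) ω)) ⁻¹' (s ×ˢ S) = Y ⁻¹' s ∩ ξ (t + 1) ⁻¹' S := rfl
    rw [Measure.map_apply (hY'.prodMk hξ) (hs.prod hS), Measure.map_apply hY' hs, e1,
      Measure.restrict_apply ((hY' hs).inter (hξ hS)), Measure.restrict_apply (hY' hs),
      ← h.law_round t _ (hY hs) i S hS, Set.inter_right_comm]
  rw [← lintegral_map (f := F) hF (hY'.prodMk hξ), ← hprod, lintegral_prod _ hF.aemeasurable,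
    lintegral_map hF.lintegral_prod_right' hY']

theorem lintegral_eq_sum_preimage (μ : Measure Ω) {k : Ω → Fin N} (hk : Measurable k)
    (f : Ω → ENNReal) : ∫⁻ ω, f ω ∂μ = ∑ i, ∫⁻ ω in k ⁻¹' {i}, f ω ∂μ := by
  rw [← setLIntegral_univ, ← Set.preimage_univ (f := k), ← Set.iUnion_of_singleton,
    Set.preimage_iUnion, lintegral_iUnion (fun i => hk (measurableSet_singleton i)), tsum_fintype]
  intro i j hij
  exact (Set.disjoint_singleton.2 hij).preimage k

theorem IsRun.lintegral_round [IsProbabilityMeasure P] (h : B.IsRun P ℱ κ ξ) (t : ℕ) {α : Type*} [MeasurableSpace α]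
    {Y : Ω → α} (hY : Measurable[ℱ t] Y) {F : Fin N → α × BanditRound 𝒳 K → ENNReal}
    (hF : ∀ i, Measurable (F i)) :
    ∫⁻ ω, F (κ (t + 1) ω) (Y ω, ξ (t + 1) ω) ∂P =
      ∫⁻ ω, ∫⁻ z, F (κ (t + 1) ω) (Y ω, z) ∂(B.roundLaw (κ (t + 1) ω)) ∂P := by
  have hκ : Measurable (κ (t + 1)) := (h.measurable_expert t).mono (ℱ.le t) le_rfl
  rw [lintegral_eq_sum_preimage P hκ, lintegral_eq_sum_preimage P hκ]
  refine Finset.sum_congr rfl fun i _ => ?_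
  have hi : MeasurableSet (κ (t + 1) ⁻¹' {i}) := hκ (measurableSet_singleton i)
  rw [setLIntegral_congr_fun (g := fun ω => F i (Y ω, ξ (t + 1) ω)) hi,
    h.setLIntegral_round t hY i (hF i)]
  · refine setLIntegral_congr_fun hi fun ω hω => ?_
    simp only [Set.mem_preimage, Set.mem_singleton_iff] at hω
    simp only [hω]
  · intro ω hω
    simp only [Set.mem_preimage, Set.mem_singleton_iff] at hω
    simp only [hω]

theorem IsRun.measurable_apply (h : B.IsRun P ℱ κ ξ) {φ : Fin N → BanditRound 𝒳 K → ℝ}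
    (hφ : ∀ i, Measurable (φ i)) {s t : ℕ} (hs : 1 ≤ s) (hst : s ≤ t) :
    Measurable[ℱ t] fun ω => φ (κ s ω) (ξ s ω) := by
  obtain ⟨s, rfl⟩ : ∃ u, s = u + 1 := ⟨s - 1, by omega⟩
  have h1 : Measurable[ℱ t] (κ (s + 1)) :=
    (h.measurable_expert s).mono (ℱ.mono (by omega)) le_rfl
  have h2 : Measurable[ℱ t] (ξ (s + 1)) := (h.measurable_round s).mono (ℱ.mono hst) le_rfl
  have h3 : Measurable fun p : Fin N × BanditRound 𝒳 K => φ p.1 p.2 :=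
    measurable_from_prod_countable_right hφ
  exact h3.comp (h1.prodMk h2)

/-- The exponential moments of a sum of bounded centred contributions of the rounds. -/
theorem IsRun.lintegral_exp_sum_le [IsProbabilityMeasure P] (h : B.IsRun P ℱ κ ξ) {φ : Fin N → BanditRound 𝒳 K → ℝ}
    (hφ : ∀ i, Measurable (φ i)) {b : ℝ}
    (hb : ∀ i, ∀ᵐ z ∂(B.roundLaw i), φ i z ∈ Set.Icc 0 b) (c : ℝ) (t : ℕ) :
    ∫⁻ ω, ENNReal.ofReal (Real.exp (c * ∑ s ∈ Finset.Icc 1 t,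
      (φ (κ s ω) (ξ s ω) - ∫ z, φ (κ s ω) z ∂(B.roundLaw (κ s ω))))) ∂P ≤
      ENNReal.ofReal (Real.exp (t * (b ^ 2 * c ^ 2 / 8))) := by
  induction t with
  | zero => simp
  | succ t ih =>
    have hsum : Measurable[ℱ t] fun ω => ∑ s ∈ Finset.Icc 1 t,
        (φ (κ s ω) (ξ s ω) - ∫ z, φ (κ s ω) z ∂(B.roundLaw (κ s ω))) := by
      refine Finset.measurable_sum _ fun s hs => ?_
      rw [Finset.mem_Icc] at hs
      exact h.measurable_apply (φ := fun i z => φ i z - ∫ z, φ i z ∂(B.roundLaw i))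
        (fun i => (hφ i).sub_const _) hs.1 hs.2
    have hstep := h.lintegral_round t hsum
      (F := fun i p => ENNReal.ofReal (Real.exp (c * p.1)) *
        ENNReal.ofReal (Real.exp (c * (φ i p.2 - ∫ z, φ i z ∂(B.roundLaw i)))))
      (fun i => by
        have := hφ i
        fun_prop)
    have hone : ∀ i, ∫⁻ z, ENNReal.ofReal (Real.exp (c * (φ i z - ∫ z, φ i z ∂(B.roundLaw i))))
        ∂(B.roundLaw i) ≤ ENNReal.ofReal (Real.exp (b ^ 2 * c ^ 2 / 8)) := by
      intro i
      -- Hoeffding's lemma: a variable in `[0, b]` has variance proxy `(b / 2)²`, whence the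
      -- exponent `b² c² / 8`.
      have hsg := hasSubgaussianMGF_of_mem_Icc (hφ i).aemeasurable (hb i)
      rw [← ofReal_integral_eq_lintegral_ofReal (hsg.integrable_exp_mul c)
        (ae_of_all _ fun z => (Real.exp_pos _).le)]
      refine ENNReal.ofReal_le_ofReal ((hsg.mgf_le c).trans (Real.exp_le_exp.2 (le_of_eq ?_)))
      simp only [sub_zero, NNReal.coe_pow, NNReal.coe_div, coe_nnnorm, Real.norm_eq_abs,
        NNReal.coe_ofNat, div_pow, sq_abs]
      ring
    calc _ = ∫⁻ ω, ENNReal.ofReal (Real.exp (c * ∑ s ∈ Finset.Icc 1 t,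
              (φ (κ s ω) (ξ s ω) - ∫ z, φ (κ s ω) z ∂(B.roundLaw (κ s ω))))) *
            ENNReal.ofReal (Real.exp (c * (φ (κ (t + 1) ω) (ξ (t + 1) ω) -
              ∫ z, φ (κ (t + 1) ω) z ∂(B.roundLaw (κ (t + 1) ω))))) ∂P := by
          refine lintegral_congr fun ω => ?_
          rw [Finset.sum_Icc_succ_top (by omega), mul_add, Real.exp_add,
            ENNReal.ofReal_mul (Real.exp_pos _).le]
      _ = _ := hstep
      _ ≤ ∫⁻ ω, ENNReal.ofReal (Real.exp (c * ∑ s ∈ Finset.Icc 1 t,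
              (φ (κ s ω) (ξ s ω) - ∫ z, φ (κ s ω) z ∂(B.roundLaw (κ s ω))))) *
            ENNReal.ofReal (Real.exp (b ^ 2 * c ^ 2 / 8)) ∂P := by
          refine lintegral_mono fun ω => ?_
          simp only
          rw [lintegral_const_mul' _ _ ENNReal.ofReal_ne_top]
          exact mul_le_mul_right (hone _) _
      _ ≤ ENNReal.ofReal (Real.exp (t * (b ^ 2 * c ^ 2 / 8))) *
            ENNReal.ofReal (Real.exp (b ^ 2 * c ^ 2 / 8)) := by
          rw [lintegral_mul_const' _ _ ENNReal.ofReal_ne_top]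
          gcongr
      _ = _ := by
          rw [← ENNReal.ofReal_mul (Real.exp_pos _).le, ← Real.exp_add]
          push_cast
          ring_nf

/-- The Azuma–Hoeffding inequality for bounded contributions of the rounds. -/
theorem IsRun.measure_abs_sum_ge_le [IsProbabilityMeasure P] (h : B.IsRun P ℱ κ ξ) {φ : Fin N → BanditRound 𝒳 K → ℝ}
    (hφ : ∀ i, Measurable (φ i)) {b : ℝ} (hb0 : 0 < b)
    (hb : ∀ i, ∀ᵐ z ∂(B.roundLaw i), φ i z ∈ Set.Icc 0 b) {t : ℕ} (ht : 0 < t) {u : ℝ}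
    (hu : 0 ≤ u) :
    P {ω | u ≤ |∑ s ∈ Finset.Icc 1 t,
      (φ (κ s ω) (ξ s ω) - ∫ z, φ (κ s ω) z ∂(B.roundLaw (κ s ω)))|} ≤
      ENNReal.ofReal (2 * Real.exp (-(2 * u ^ 2 / (t * b ^ 2)))) := by
  set S : Ω → ℝ := fun ω => ∑ s ∈ Finset.Icc 1 t,
      (φ (κ s ω) (ξ s ω) - ∫ z, φ (κ s ω) z ∂(B.roundLaw (κ s ω))) with hS
  have ht' : (0 : ℝ) < t := by exact_mod_cast ht
  have hSm : Measurable S := by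
    refine Finset.measurable_sum _ fun s hs => ?_
    rw [Finset.mem_Icc] at hs
    exact (h.measurable_apply (φ := fun i z => φ i z - ∫ z, φ i z ∂(B.roundLaw i))
      (fun i => (hφ i).sub_const _) hs.1 hs.2).mono (ℱ.le t) le_rfl
  have hside : ∀ ε : ℝ, ε ^ 2 = 1 → P {ω | u ≤ ε * S ω} ≤
      ENNReal.ofReal (Real.exp (-(2 * u ^ 2 / (t * b ^ 2)))) := by
    intro ε hε
    -- The minimizer of the Chernoff exponent `t b² c² / 8 - c u`.
    set c : ℝ := 4 * u / (t * b ^ 2) with hc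
    have hc0 : 0 ≤ c := by positivity
    have hmgf := h.lintegral_exp_sum_le hφ hb (c * ε) t
    have hmarkov := mul_meas_ge_le_lintegral₀ (μ := P)
      (f := fun ω => ENNReal.ofReal (Real.exp (c * ε * S ω)))
      (by fun_prop) (ENNReal.ofReal (Real.exp (c * u)))
    have hsub : {ω | u ≤ ε * S ω} ⊆ {ω | ENNReal.ofReal (Real.exp (c * u)) ≤
        ENNReal.ofReal (Real.exp (c * ε * S ω))} := by
      intro ω hω
      refine ENNReal.ofReal_le_ofReal (Real.exp_le_exp.2 ?_)
      rw [mul_assoc]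
      exact mul_le_mul_of_nonneg_left hω hc0
    calc P {ω | u ≤ ε * S ω} ≤ _ := measure_mono hsub
      _ = ENNReal.ofReal (Real.exp (-(c * u))) * (ENNReal.ofReal (Real.exp (c * u)) *
          P {ω | ENNReal.ofReal (Real.exp (c * u)) ≤
            ENNReal.ofReal (Real.exp (c * ε * S ω))}) := by
          rw [← mul_assoc, ← ENNReal.ofReal_mul (Real.exp_pos _).le, ← Real.exp_add]
          simp
      _ ≤ ENNReal.ofReal (Real.exp (-(c * u))) *
          ENNReal.ofReal (Real.exp (t * (b ^ 2 * (c * ε) ^ 2 / 8))) := by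
          gcongr
          exact hmarkov.trans hmgf
      _ = _ := by
          rw [← ENNReal.ofReal_mul (Real.exp_pos _).le, ← Real.exp_add, mul_pow, hε, hc]
          congr 2
          field_simp
          ring
  calc P {ω | u ≤ |S ω|} ≤ P ({ω | u ≤ 1 * S ω} ∪ {ω | u ≤ (-1) * S ω}) := by
        refine measure_mono fun ω hω => ?_
        rcases le_abs.1 (show u ≤ |S ω| from hω) with h1 | h1
        · left; simpa using h1
        · right; simpa using h1
    _ ≤ P {ω | u ≤ 1 * S ω} + P {ω | u ≤ (-1) * S ω} := measure_union_le _ _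
    _ ≤ _ := add_le_add (hside 1 (by norm_num)) (hside (-1) (by norm_num))
    _ = _ := by
        rw [← ENNReal.ofReal_add (Real.exp_pos _).le (Real.exp_pos _).le, ← two_mul]

theorem sum_group (g : ℕ → ℕ) (t r : ℕ) (f : ℕ → ℝ) :
    ∑ s ∈ group g t r, f s = ∑ s ∈ Finset.Icc 1 t, if g s = r then f s else 0 :=
  Finset.sum_filter _ _

theorem card_group (g : ℕ → ℕ) (t r : ℕ) :
    ((group g t r).card : ℝ) = ∑ s ∈ Finset.Icc 1 t, if g s = r then (1 : ℝ) else 0 := by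
  rw [← sum_group g t r fun _ => 1]; simp

theorem group_mono (g : ℕ → ℕ) {t n : ℕ} (h : t ≤ n) (r : ℕ) : group g t r ⊆ group g n r :=
  Finset.filter_subset_filter _ (Finset.Icc_subset_Icc_right h)

/-- The one-step estimate of the supermartingale: the cross term has mean zero, and the second
moment, at most `1`, is paid for by the decrease from `a` to `a - 1`. The condition `1 ≤ a` keeps
the integrand nonnegative, so that `ENNReal.ofReal` does not truncate. -/
theorem lintegral_add_sq_le (i : Fin N) {φ : BanditRound 𝒳 K → ℝ}
    (hint : Integrable φ (B.roundLaw i)) (hint2 : Integrable (fun z => φ z ^ 2) (B.roundLaw i))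
    (h0 : ∫ z, φ z ∂(B.roundLaw i) = 0) (h1 : ∫ z, φ z ^ 2 ∂(B.roundLaw i) ≤ 1)
    {a d : ℝ} (ha : 1 ≤ a) :
    ∫⁻ z, ENNReal.ofReal (a - 1 + (d + φ z) ^ 2) ∂(B.roundLaw i) ≤
      ENNReal.ofReal (a + d ^ 2) := by
  have he : (fun z => a - 1 + (d + φ z) ^ 2) =
      fun z => (a - 1 + d ^ 2) + (2 * d * φ z + φ z ^ 2) := by
    funext z; ring
  have hi := (hint.const_mul (2 * d)).add hint2
  have hi' : Integrable (fun z => 2 * d * φ z + φ z ^ 2) (B.roundLaw i) := hi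
  rw [← ofReal_integral_eq_lintegral_ofReal]
  · refine ENNReal.ofReal_le_ofReal ?_
    rw [he, integral_add (integrable_const _) hi', integral_add (hint.const_mul _) hint2,
      integral_const_mul, h0, integral_const]
    simp only [probReal_univ, one_smul]
    linarith
  · rw [he]
    exact (integrable_const _).add hi'
  · exact ae_of_all _ fun z => by
      have := sq_nonneg (d + φ z)
      simp only [Pi.zero_apply]
      linarith

/-- Centred contributions of the rounds with second moments at most `1`, summed over predictable
groups: the corrected squares of these sums have a product that is a supermartingale. -/
theorem IsRun.lintegral_prod_group_le [IsProbabilityMeasure P] (h : B.IsRun P ℱ κ ξ)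
    {g : ℕ → Ω → ℕ} (hg : ∀ s, Measurable[ℱ s] (g (s + 1)))
    {φ : Fin N → BanditRound 𝒳 K → ℝ} (hφ : ∀ i, Measurable (φ i))
    (hint : ∀ i, Integrable (φ i) (B.roundLaw i))
    (hint2 : ∀ i, Integrable (fun z => φ i z ^ 2) (B.roundLaw i))
    (h0 : ∀ i, ∫ z, φ i z ∂(B.roundLaw i) = 0) (h1 : ∀ i, ∫ z, φ i z ^ 2 ∂(B.roundLaw i) ≤ 1)
    (R : Finset ℕ) {b : ℝ} {n : ℕ}
    (hb : ∀ ω, ∀ r ∈ R, ((group (fun s => g s ω) n r).card : ℝ) ≤ b) (t : ℕ) (ht : t ≤ n) :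
    ∫⁻ ω, ∏ r ∈ R, ENNReal.ofReal (b - (group (fun s => g s ω) t r).card +
      (∑ s ∈ group (fun s => g s ω) t r, φ (κ s ω) (ξ s ω)) ^ 2) ∂P ≤
      ENNReal.ofReal b ^ R.card := by
  induction t with
  | zero => simp [group]
  | succ t ih =>
    have hgm : ∀ s ∈ Finset.Icc 1 t, ∀ r, MeasurableSet[ℱ t] {ω | g s ω = r} := by
      intro s hs r
      rw [Finset.mem_Icc] at hs
      obtain ⟨s, rfl⟩ : ∃ u, s = u + 1 := ⟨s - 1, by omega⟩
      exact ((hg s).mono (ℱ.mono (by omega)) le_rfl) (measurableSet_singleton r)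
    have hD : Measurable[ℱ t] fun ω => fun r : ℕ =>
        ∑ s ∈ group (fun s => g s ω) t r, φ (κ s ω) (ξ s ω) := by
      refine @measurable_pi_lambda _ _ _ (ℱ t) _ _ fun r => ?_
      simp only [sum_group]
      refine Finset.measurable_sum _ fun s hs => ?_
      refine Measurable.ite (hgm s hs r) ?_ measurable_const
      rw [Finset.mem_Icc] at hs
      exact h.measurable_apply hφ hs.1 hs.2
    have hC : Measurable[ℱ t] fun ω => fun r : ℕ =>
        ((group (fun s => g s ω) t r).card : ℝ) := by
      refine @measurable_pi_lambda _ _ _ (ℱ t) _ _ fun r => ?_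
      simp only [card_group]
      refine Finset.measurable_sum _ fun s hs => ?_
      exact Measurable.ite (hgm s hs r) measurable_const measurable_const
    have hstep := h.lintegral_round t (hD.prodMk (hC.prodMk (hg t)))
      (F := fun i p => ∏ r ∈ R, ENNReal.ofReal
        (b - (p.1.2.1 r + if p.1.2.2 = r then 1 else 0) +
          (p.1.1 r + if p.1.2.2 = r then φ i p.2 else 0) ^ 2))
      (fun i => by
        refine Finset.measurable_prod _ fun r _ => Measurable.ennreal_ofReal ?_
        have hset : MeasurableSet {p : ((ℕ → ℝ) × (ℕ → ℝ) × ℕ) × BanditRound 𝒳 K |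
            p.1.2.2 = r} :=
          measurable_fst.snd.snd (measurableSet_singleton r)
        have e1 : Measurable fun p : ((ℕ → ℝ) × (ℕ → ℝ) × ℕ) × BanditRound 𝒳 K =>
            if p.1.2.2 = r then (1 : ℝ) else 0 :=
          Measurable.ite hset measurable_const measurable_const
        have e2 : Measurable fun p : ((ℕ → ℝ) × (ℕ → ℝ) × ℕ) × BanditRound 𝒳 K =>
            if p.1.2.2 = r then φ i p.2 else 0 :=
          Measurable.ite hset ((hφ i).comp measurable_snd) measurable_const
        have e3 : Measurable fun p : ((ℕ → ℝ) × (ℕ → ℝ) × ℕ) × BanditRound 𝒳 K =>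
            p.1.2.1 r := by fun_prop
        have e4 : Measurable fun p : ((ℕ → ℝ) × (ℕ → ℝ) × ℕ) × BanditRound 𝒳 K =>
            p.1.1 r := by fun_prop
        exact ((e3.add e1).const_sub b).add ((e4.add e2).pow_const 2))
    refine le_trans (le_of_eq ?_) ((hstep.trans_le (lintegral_mono fun ω => ?_)).trans
      (ih (by omega)))
    · refine lintegral_congr fun ω => Finset.prod_congr rfl fun r _ => ?_
      simp only [sum_group, card_group, Finset.sum_Icc_succ_top (show 1 ≤ t + 1 by omega)]
    · simp only
      -- At most one factor changes, that of the group joined by round `t + 1`, and this group is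
      -- known before the round.
      by_cases hr : g (t + 1) ω ∈ R
      · rw [← Finset.mul_prod_erase R _ hr]
        have hrest : ∀ z, (∏ r ∈ R, ENNReal.ofReal
            (b - ((group (fun s => g s ω) t r).card + if g (t + 1) ω = r then 1 else 0) +
              ((∑ s ∈ group (fun s => g s ω) t r, φ (κ s ω) (ξ s ω)) +
                if g (t + 1) ω = r then φ (κ (t + 1) ω) z else 0) ^ 2)) =
            ENNReal.ofReal (b - (group (fun s => g s ω) t (g (t + 1) ω)).card - 1 +
              ((∑ s ∈ group (fun s => g s ω) t (g (t + 1) ω), φ (κ s ω) (ξ s ω)) +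
                φ (κ (t + 1) ω) z) ^ 2) *
            ∏ r ∈ R.erase (g (t + 1) ω), ENNReal.ofReal
              (b - (group (fun s => g s ω) t r).card +
                (∑ s ∈ group (fun s => g s ω) t r, φ (κ s ω) (ξ s ω)) ^ 2) := by
          intro z
          rw [← Finset.mul_prod_erase R _ hr]
          congr 1
          · simp only [if_true, sub_sub]
          · refine Finset.prod_congr rfl fun r hr' => ?_
            simp [(Finset.ne_of_mem_erase hr').symm]
        simp only [hrest]
        rw [lintegral_mul_const' _ _
          (ENNReal.prod_ne_top fun r _ => ENNReal.ofReal_ne_top)]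
        refine mul_le_mul_left (lintegral_add_sq_le _ (hint _) (hint2 _) (h0 _) (h1 _) ?_) _
        -- Round `t + 1 ≤ n` is yet to join this group, so its size so far is at most `b - 1`, as
        -- the one-step estimate requires.
        have hcard : (group (fun s => g s ω) t (g (t + 1) ω)).card + 1 ≤
            (group (fun s => g s ω) n (g (t + 1) ω)).card := by
          rw [← Finset.card_insert_of_notMem (a := t + 1)]
          · refine Finset.card_le_card (Finset.insert_subset ?_ (group_mono _ (by omega) _))
            simp only [group, Finset.mem_filter, Finset.mem_Icc, and_true]
            omega
          · simp [group]
        have hcard' : ((group (fun s => g s ω) t (g (t + 1) ω)).card : ℝ) + 1 ≤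
            (group (fun s => g s ω) n (g (t + 1) ω)).card := by exact_mod_cast hcard
        linarith [hb ω _ hr]
      · have hconst : ∀ z, (∏ r ∈ R, ENNReal.ofReal
            (b - ((group (fun s => g s ω) t r).card + if g (t + 1) ω = r then 1 else 0) +
              ((∑ s ∈ group (fun s => g s ω) t r, φ (κ s ω) (ξ s ω)) +
                if g (t + 1) ω = r then φ (κ (t + 1) ω) z else 0) ^ 2)) =
            ∏ r ∈ R, ENNReal.ofReal (b - (group (fun s => g s ω) t r).card +
                (∑ s ∈ group (fun s => g s ω) t r, φ (κ s ω) (ξ s ω)) ^ 2) := by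
          intro z
          refine Finset.prod_congr rfl fun r hr' => ?_
          have : g (t + 1) ω ≠ r := fun e => hr (e ▸ hr')
          simp [this]
        simp only [hconst]
        simp

/-- If centred contributions of the rounds with second moments at most `1` are summed over
predictable groups of size at most `b`, then the sums of the groups in `R` are all large with
probability exponentially small in the size of `R`. -/
theorem IsRun.measure_forall_group_le [IsProbabilityMeasure P] (h : B.IsRun P ℱ κ ξ)
    {g : ℕ → Ω → ℕ} (hg : ∀ s, Measurable[ℱ s] (g (s + 1)))
    {φ : Fin N → BanditRound 𝒳 K → ℝ} (hφ : ∀ i, Measurable (φ i))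
    (hint : ∀ i, Integrable (φ i) (B.roundLaw i))
    (hint2 : ∀ i, Integrable (fun z => φ i z ^ 2) (B.roundLaw i))
    (h0 : ∀ i, ∫ z, φ i z ∂(B.roundLaw i) = 0) (h1 : ∀ i, ∫ z, φ i z ^ 2 ∂(B.roundLaw i) ≤ 1)
    (R : Finset ℕ) {b θ : ℝ} (hb0 : 0 ≤ b) (hθ : 0 < θ) {n : ℕ}
    (hb : ∀ ω, ∀ r ∈ R, ((group (fun s => g s ω) n r).card : ℝ) ≤ b) :
    P {ω | ∀ r ∈ R, θ ≤ (∑ s ∈ group (fun s => g s ω) n r, φ (κ s ω) (ξ s ω)) ^ 2} ≤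
      ENNReal.ofReal ((b / θ) ^ R.card) := by
  have hle := h.lintegral_prod_group_le hg hφ hint hint2 h0 h1 R hb n le_rfl
  have hgm : ∀ s ∈ Finset.Icc 1 n, ∀ r, MeasurableSet {ω | g s ω = r} := by
    intro s hs r
    rw [Finset.mem_Icc] at hs
    obtain ⟨s, rfl⟩ : ∃ u, s = u + 1 := ⟨s - 1, by omega⟩
    exact ((hg s).mono (ℱ.le _) le_rfl) (measurableSet_singleton r)
  have hmeas : Measurable fun ω => ∏ r ∈ R, ENNReal.ofReal
      (b - (group (fun s => g s ω) n r).card +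
        (∑ s ∈ group (fun s => g s ω) n r, φ (κ s ω) (ξ s ω)) ^ 2) := by
    refine Finset.measurable_prod _ fun r _ => Measurable.ennreal_ofReal ?_
    simp only [card_group, sum_group]
    refine Measurable.add (Measurable.const_sub (Finset.measurable_sum _ fun s hs => ?_) b)
      (Measurable.pow_const (Finset.measurable_sum _ fun s hs => ?_) 2)
    · exact Measurable.ite (hgm s hs r) measurable_const measurable_const
    · refine Measurable.ite (hgm s hs r) ?_ measurable_const
      rw [Finset.mem_Icc] at hs
      exact (h.measurable_apply hφ hs.1 le_rfl).mono (ℱ.le _) le_rfl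
  have hmarkov := mul_meas_ge_le_lintegral₀ (μ := P) hmeas.aemeasurable
    (ENNReal.ofReal θ ^ R.card)
  have hsub : {ω | ∀ r ∈ R, θ ≤ (∑ s ∈ group (fun s => g s ω) n r, φ (κ s ω) (ξ s ω)) ^ 2} ⊆
      {ω | ENNReal.ofReal θ ^ R.card ≤ ∏ r ∈ R, ENNReal.ofReal
        (b - (group (fun s => g s ω) n r).card +
          (∑ s ∈ group (fun s => g s ω) n r, φ (κ s ω) (ξ s ω)) ^ 2)} := by
    intro ω hω
    simp only [Set.mem_ofPred_eq] at hω ⊢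
    rw [← Finset.prod_const]
    refine Finset.prod_le_prod' fun r hr => ENNReal.ofReal_le_ofReal ?_
    linarith [hω r hr, hb ω r hr]
  have hθ' : ENNReal.ofReal θ ^ R.card ≠ 0 :=
    pow_ne_zero _ (ENNReal.ofReal_pos.2 hθ).ne'
  have hθt : ENNReal.ofReal θ ^ R.card ≠ ⊤ := ENNReal.pow_ne_top ENNReal.ofReal_ne_top
  rw [div_pow, ENNReal.ofReal_div_of_pos (pow_pos hθ _), ENNReal.ofReal_pow hb0,
    ENNReal.ofReal_pow hθ.le, ENNReal.le_div_iff_mul_le (Or.inl hθ') (Or.inl hθt), mul_comm]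
  calc _ ≤ _ := mul_le_mul_right (measure_mono hsub) _
    _ ≤ _ := hmarkov.trans hle

end ExpertBandit

/-! ### From gap bounds to regret -/

theorem sum_one_div_sq_le_two (n : ℕ) : ∑ u ∈ Finset.range n, 1 / ((u + 1 : ℕ) : ℝ) ^ 2 ≤ 2 := by
  -- Telescoping. Since `1 / 0 = 0`, the step from `n = 0` is treated separately.
  have h : ∑ u ∈ Finset.range n, 1 / ((u + 1 : ℕ) : ℝ) ^ 2 ≤ 2 - 1 / (n : ℝ) := by
    induction n with
    | zero => norm_num
    | succ n ih =>
      rcases Nat.eq_zero_or_pos n with rfl | hn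
      · norm_num
      rw [Finset.sum_range_succ]
      have hn' : (0 : ℝ) < n := by exact_mod_cast hn
      have h1 : 1 / ((n + 1 : ℕ) : ℝ) ^ 2 ≤ 1 / (n : ℝ) - 1 / (n + 1 : ℕ) := by
        push_cast
        rw [div_sub_div _ _ hn'.ne' (by positivity), div_le_div_iff₀ (by positivity)
          (by positivity)]
        nlinarith
      linarith
  have h2 : (0 : ℝ) ≤ 1 / (n : ℝ) := by positivity
  linarith

/-- The sum of the first `n` roots is at most `2 √(A n)`, and the terms stop counting once `n > A /
Δ²`. The minimum in the induction records both: when the term `x = √(A / (n + 1))` counts, `√(A (n +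
1)) = A / x ≤ A / Δ`, and this root exceeds `√(A n)` by at least `x / 2`. -/
theorem sum_sqrt_div_le {A Δ : ℝ} (hA : 0 ≤ A) (hΔ : 0 < Δ) (n : ℕ) :
    ∑ u ∈ Finset.range n, (if Δ ≤ √(A / (u + 1 : ℕ)) then √(A / (u + 1 : ℕ)) else 0) ≤
      2 * (A / Δ) := by
  suffices h : ∑ u ∈ Finset.range n,
      (if Δ ≤ √(A / (u + 1 : ℕ)) then √(A / (u + 1 : ℕ)) else 0) ≤
      2 * min (√(A * n)) (A / Δ) by
    linarith [min_le_right (√(A * n)) (A / Δ)]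
  induction n with
  | zero => simp; positivity
  | succ n ih =>
    rw [Finset.sum_range_succ]
    have hn : (0 : ℝ) < (n + 1 : ℕ) := by positivity
    have hle : √(A * n) ≤ √(A * (n + 1 : ℕ)) := Real.sqrt_le_sqrt (by gcongr; simp)
    split_ifs with hc
    · set x := √(A / (n + 1 : ℕ)) with hx
      have hx0 : 0 < x := hΔ.trans_le hc
      have hx2 : x ^ 2 * (n + 1 : ℕ) = A := by
        rw [hx, Real.sq_sqrt (by positivity)]; field_simp
      have hr : √(A * (n + 1 : ℕ)) = x * (n + 1 : ℕ) := by
        rw [← hx2, show x ^ 2 * ((n + 1 : ℕ) : ℝ) * (n + 1 : ℕ) = (x * (n + 1 : ℕ)) ^ 2 by ring,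
          Real.sqrt_sq (by positivity)]
      have hl : √(A * n) ≤ x * (n + 1 : ℕ) - x / 2 := by
        rw [Real.sqrt_le_left (by push_cast; nlinarith [mul_nonneg hx0.le (Nat.cast_nonneg (α := ℝ) n)])]
        rw [← hx2]
        push_cast
        nlinarith [sq_nonneg x]
      have hm : √(A * (n + 1 : ℕ)) ≤ A / Δ := by
        rw [hr, le_div_iff₀ hΔ, ← hx2]
        have := mul_le_mul_of_nonneg_left hc (mul_pos hx0 hn).le
        nlinarith
      rw [min_eq_left hm, hr]
      linarith [min_le_left (√(A * n)) (A / Δ)]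
    · rw [add_zero]
      exact ih.trans (by gcongr)

namespace ExpertBandit

variable {𝒳 : Type*} [MeasurableSpace 𝒳] {K N : ℕ} {B : ExpertBandit 𝒳 K N}

variable {Ω : Type*} [mΩ : MeasurableSpace Ω] {P : Measure Ω}
  {ℱ : Filtration ℕ mΩ} {κ : ℕ → Ω → Fin N} {ξ : ℕ → Ω → BanditRound 𝒳 K}

theorem IsRun.ae_round (h : B.IsRun P ℱ κ ξ) {S : Set (BanditRound 𝒳 K)} (hS : MeasurableSet S)
    (hae : ∀ i, ∀ᵐ z ∂(B.roundLaw i), z ∈ S) (t : ℕ) : ∀ᵐ ω ∂P, ξ (t + 1) ω ∈ S := by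
  have hsub : {ω | ¬ ξ (t + 1) ω ∈ S} ⊆
      ⋃ i, Set.univ ∩ κ (t + 1) ⁻¹' {i} ∩ ξ (t + 1) ⁻¹' Sᶜ := by
    intro ω hω
    exact Set.mem_iUnion.2 ⟨κ (t + 1) ω, ⟨trivial, rfl⟩, hω⟩
  refine measure_mono_null hsub (measure_iUnion_null fun i => ?_)
  rw [h.law_round t _ MeasurableSet.univ i _ hS.compl]
  have : B.roundLaw i Sᶜ = 0 := hae i
  rw [this, mul_zero]

theorem IsRun.ae_reward_mem_Icc (h : B.IsRun P ℱ κ ξ) :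
    ∀ᵐ ω ∂P, ∀ s, 1 ≤ s → (ξ s ω).reward ∈ Set.Icc (0 : ℝ) 1 := by
  have h1 : ∀ᵐ ω ∂P, ∀ t, (ξ (t + 1) ω).reward ∈ Set.Icc (0 : ℝ) 1 :=
    ae_all_iff.2 fun t => h.ae_round (S := {z | z.reward ∈ Set.Icc (0 : ℝ) 1})
      (measurable_reward measurableSet_Icc) (fun i => B.reward_mem_Icc i) t
  filter_upwards [h1] with ω hω s hs
  obtain ⟨s, rfl⟩ : ∃ u, s = u + 1 := ⟨s - 1, by omega⟩
  exact hω s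

/-- If, from some time on, the gap of the selected expert is at most `√(A / t)` up to a small
failure probability, then the regret is at most of order `A / Δ_(2)`. -/
theorem IsRun.regret_le [IsProbabilityMeasure P] (h : B.IsRun P ℱ κ ξ) (hN : 2 ≤ N)
    (hΔ : 0 < B.sortedGap 2) {t₀ T : ℕ} {c A : ℝ} (hc : 0 ≤ c) (hA : 0 ≤ A)
    (hbad : ∀ t, 1 ≤ t → t₀ ≤ t → t < T →
      P {ω | ¬ B.gap (κ (t + 1) ω) ≤ √(A / t)} ≤ ENNReal.ofReal (c / t ^ 2)) :
    B.regret P κ T ≤ t₀ + 1 + 2 * c + 2 * (A / B.sortedGap 2) := by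
  set Δ := B.sortedGap 2 with hΔdef
  have hκ : ∀ t, Measurable (κ (t + 1)) := fun t => (h.measurable_expert t).mono (ℱ.le t) le_rfl
  have hgm : ∀ t, Measurable fun ω => B.gap (κ (t + 1) ω) := fun t =>
    (measurable_of_finite B.gap).comp (hκ t)
  have hgi : ∀ t, Integrable (fun ω => B.gap (κ (t + 1) ω)) P := fun t =>
    Integrable.of_mem_Icc 0 1 (hgm t).aemeasurable
      (ae_of_all _ fun ω => ⟨B.gap_nonneg _, B.gap_le_one _⟩)
  have hone : ∀ t, ∫ ω, B.gap (κ (t + 1) ω) ∂P ≤ 1 := fun t => by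
    have := integral_mono (hgi t) (integrable_const (1 : ℝ)) fun ω => B.gap_le_one _
    simpa using this
  set H : ℕ → ℝ := fun t => if Δ ≤ √(A / t) then √(A / t) else 0 with hH
  have hH0 : ∀ t, 0 ≤ H t := fun t => by
    simp only [hH]; split_ifs <;> positivity
  have hlate : ∀ t, 1 ≤ t → t₀ ≤ t → t < T →
      ∫ ω, B.gap (κ (t + 1) ω) ∂P ≤ H t + c / t ^ 2 := by
    intro t ht1 ht0 htT
    set E : Set Ω := {ω | ¬ B.gap (κ (t + 1) ω) ≤ √(A / t)} with hE
    have hEm : MeasurableSet E := (measurableSet_le (hgm t) measurable_const).compl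
    have hPE : P.real E ≤ c / t ^ 2 := by
      rw [Measure.real]
      exact ENNReal.toReal_le_of_le_ofReal (by positivity) (hbad t ht1 ht0 htT)
    have hle : ∀ ω, B.gap (κ (t + 1) ω) ≤ H t + E.indicator 1 ω := by
      intro ω
      by_cases hω : ω ∈ E
      · rw [Set.indicator_of_mem hω, Pi.one_apply]
        linarith [B.gap_le_one (κ (t + 1) ω), hH0 t]
      · rw [Set.indicator_of_notMem hω, add_zero]
        have hg : B.gap (κ (t + 1) ω) ≤ √(A / t) := not_not.1 hω
        rcases B.gap_eq_zero_or_le hN (κ (t + 1) ω) with h0 | h0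
        · rw [h0]; exact hH0 t
        · simp only [hH]
          rw [if_pos (h0.trans hg)]
          exact hg
    have hi : Integrable (E.indicator (1 : Ω → ℝ)) P :=
      (integrable_const (1 : ℝ)).indicator hEm
    have := integral_mono (hgi t) ((integrable_const (H t)).add hi) hle
    rw [integral_add' (integrable_const _) hi, integral_indicator_one hEm] at this
    simp only [integral_const, probReal_univ, one_smul] at this
    linarith
  have hsum : B.regret P κ T = ∑ t ∈ Finset.range T, ∫ ω, B.gap (κ (t + 1) ω) ∂P := by
    rw [regret, ← integral_finsetSum _ fun t _ => hgi t]
    refine integral_congr_ae (ae_of_all _ fun ω => ?_)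
    simp only
    rw [Finset.range_eq_Ico, Finset.sum_Ico_add' (fun t => B.gap (κ t ω)) 0 T 1, zero_add]
    rfl
  have hterm : ∀ t ∈ Finset.range T, ∫ ω, B.gap (κ (t + 1) ω) ∂P ≤
      (if t < t₀ + 1 then 1 else 0) + (if 1 ≤ t then H t + c / t ^ 2 else 0) := by
    intro t ht
    rw [Finset.mem_range] at ht
    have hpos : 0 ≤ H t + c / (t : ℝ) ^ 2 := add_nonneg (hH0 t) (by positivity)
    by_cases h1 : t < t₀ + 1
    · rw [if_pos h1]
      have := hone t
      split_ifs <;> linarith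
    · rw [if_neg h1, if_pos (by omega), zero_add]
      exact hlate t (by omega) (by omega) ht
  rw [hsum]
  refine (Finset.sum_le_sum hterm).trans ?_
  rw [Finset.sum_add_distrib]
  -- The index `t` stands for round `t + 1`; `t = 0` is the first round, which is always charged the
  -- trivial bound `1`.
  have hA1 : ∑ t ∈ Finset.range T, (if t < t₀ + 1 then (1 : ℝ) else 0) ≤ t₀ + 1 := by
    rw [← Finset.sum_filter]
    simp only [Finset.sum_const, nsmul_eq_mul, mul_one]
    have : ((Finset.range T).filter fun t => t < t₀ + 1).card ≤ t₀ + 1 := by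
      refine (Finset.card_le_card fun t ht => ?_).trans (Finset.card_range (t₀ + 1)).le
      exact Finset.mem_range.2 (Finset.mem_filter.1 ht).2
    exact_mod_cast this
  have hA2 : ∑ t ∈ Finset.range T, (if 1 ≤ t then H t + c / (t : ℝ) ^ 2 else 0) ≤
      2 * (A / Δ) + 2 * c := by
    have hle : ∑ t ∈ Finset.range T, (if 1 ≤ t then H t + c / (t : ℝ) ^ 2 else 0) ≤
        ∑ t ∈ Finset.range (T + 1), (if 1 ≤ t then H t + c / (t : ℝ) ^ 2 else 0) := by
      refine Finset.sum_le_sum_of_subset_of_nonneg (Finset.range_mono (by omega)) fun t _ _ => ?_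
      split_ifs
      · exact add_nonneg (hH0 t) (by positivity)
      · exact le_rfl
    refine hle.trans ?_
    rw [Finset.sum_range_succ', if_neg (by omega), add_zero]
    simp only [if_pos (Nat.le_add_left 1 _)]
    rw [Finset.sum_add_distrib]
    refine add_le_add (sum_sqrt_div_le hA hΔ T) ?_
    have := mul_le_mul_of_nonneg_left (sum_one_div_sq_le_two T) hc
    rw [Finset.mul_sum] at this
    simp only [mul_one_div] at this
    linarith
  linarith

end ExpertBandit

/-! ### The clipped estimator -/

/-- `b / log (2 / b)` takes every positive value on `(0, 2)`. -/
theorem exists_div_log_eq {c : ℝ} (hc : 0 < c) :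
    ∃ b : ℝ, 0 < b ∧ b < 2 ∧ b / Real.log (2 / b) = c := by
  -- Substituting `b = 2 exp(-u)` turns the equation into `2 exp(-u) = c u`.
  have hcont : ContinuousOn (fun u : ℝ => c * u - 2 * Real.exp (-u)) (Set.Icc 0 (2 / c)) := by
    fun_prop
  have hivt := intermediate_value_Icc (show (0 : ℝ) ≤ 2 / c by positivity) hcont
  have h0 : (0 : ℝ) ∈ Set.Icc (c * 0 - 2 * Real.exp (-0)) (c * (2 / c) - 2 * Real.exp (-(2 / c))) := by
    constructor
    · simp
    · have : Real.exp (-(2 / c)) ≤ 1 := Real.exp_le_one_iff.2 (by simp; positivity)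
      rw [mul_div_cancel₀ _ hc.ne']
      linarith
  obtain ⟨u, hu, hu0⟩ := hivt h0
  simp only at hu0
  have hupos : 0 < u := by
    rcases hu.1.lt_or_eq with h | h
    · exact h
    · rw [← h] at hu0; norm_num at hu0
  refine ⟨2 * Real.exp (-u), by positivity, ?_, ?_⟩
  · have : Real.exp (-u) < 1 := Real.exp_lt_one_iff.2 (by linarith)
    linarith
  · have : 2 / (2 * Real.exp (-u)) = Real.exp u := by
      rw [Real.exp_neg]; field_simp
    rw [this, Real.log_exp, div_eq_iff hupos.ne']
    linarith

namespace ExpertBandit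

variable {𝒳 : Type*} [MeasurableSpace 𝒳] {K N : ℕ} (B : ExpertBandit 𝒳 K N)

open Classical in
/-- The contribution of a round with expert `i` to the clipped estimate of `μ_k`. -/
noncomputable def clippedTerm (ε : ℝ) (k i : Fin N) (z : BanditRound 𝒳 K) : ℝ :=
  1 / B.logDiv k i * z.reward * B.ratio k i z *
    (if B.ratio k i z ≤ 2 * Real.log (2 / ε) * B.logDiv k i then 1 else 0)

open Classical in
theorem clippedTerm_eq (ε : ℝ) (k i : Fin N) (z : BanditRound 𝒳 K) :
    B.clippedTerm ε k i z = 1 / B.logDiv k i * (z.reward * B.ratio k i z *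
      (if B.ratio k i z ≤ 2 * Real.log (2 / ε) * B.logDiv k i then 1 else 0)) := by
  unfold clippedTerm; ring

theorem measurable_clippedTerm (ε : ℝ) (k i : Fin N) : Measurable (B.clippedTerm ε k i) := by
  unfold clippedTerm
  have h1 := measurable_reward (𝒳 := 𝒳) (K := K)
  have h2 := B.measurable_ratio k i
  refine ((h1.const_mul _).mul h2).mul (Measurable.ite ?_ measurable_const measurable_const)
  exact measurableSet_le h2 measurable_const

variable {B}

theorem clippedTerm_mem_Icc {ε : ℝ} {k i : Fin N} (hM : 1 ≤ B.logDiv k i)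
    (hε : 0 ≤ Real.log (2 / ε)) {z : BanditRound 𝒳 K} (hz : z.reward ∈ Set.Icc (0 : ℝ) 1) :
    B.clippedTerm ε k i z ∈ Set.Icc 0 (2 * Real.log (2 / ε)) := by
  have hρ := B.ratio_nonneg k i z
  have hz0 := hz.1
  unfold clippedTerm
  split_ifs with h
  · refine ⟨by positivity, ?_⟩
    rw [mul_one, one_div, mul_assoc, ← div_eq_inv_mul, div_le_iff₀ (by linarith)]
    nlinarith [mul_le_mul_of_nonneg_right hz.2 hρ]
  · rw [mul_zero]
    exact ⟨le_rfl, by positivity⟩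

theorem clippedTerm_nonneg {ε : ℝ} {k i : Fin N} (hM : 1 ≤ B.logDiv k i)
    {z : BanditRound 𝒳 K} (hz : 0 ≤ z.reward) : 0 ≤ B.clippedTerm ε k i z := by
  have hρ := B.ratio_nonneg k i z
  unfold clippedTerm
  split_ifs <;> positivity

/-- A smaller level clips less, and the terms are nonnegative. This sandwiches the sum at the random
level `β` between sums at deterministic levels. -/
theorem clippedTerm_anti {ε ε' : ℝ} (hε : 0 < ε) (hle : ε ≤ ε') {k i : Fin N}
    (hM : 1 ≤ B.logDiv k i) {z : BanditRound 𝒳 K} (hz : 0 ≤ z.reward) :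
    B.clippedTerm ε' k i z ≤ B.clippedTerm ε k i z := by
  have hρ := B.ratio_nonneg k i z
  have hlog : Real.log (2 / ε') ≤ Real.log (2 / ε) :=
    Real.log_le_log (by have := hε.trans_le hle; positivity) (by gcongr)
  have hthr : 2 * Real.log (2 / ε') * B.logDiv k i ≤ 2 * Real.log (2 / ε) * B.logDiv k i := by
    gcongr
  unfold clippedTerm
  refine mul_le_mul_of_nonneg_left ?_ (by positivity)
  split_ifs with h1 h2
  · exact le_rfl
  · exact absurd (h1.trans hthr) h2
  · exact zero_le_one
  · exact le_rfl

/-- The bias of the clipped estimate. -/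
theorem integral_clippedTerm_mem_Icc {ε : ℝ} (hε : 0 < ε) (hε1 : ε ≤ 2 / 3) {k i : Fin N}
    (h : B.expDiv k i ≠ ⊤) :
    ∫ z, B.clippedTerm ε k i z ∂(B.roundLaw i) ∈
      Set.Icc (1 / B.logDiv k i * (B.mean k - ε / 2)) (1 / B.logDiv k i * B.mean k) := by
  obtain ⟨hac, hM, hint, hD⟩ := expDiv_spec h
  -- The restriction `ε ≤ 2 / 3` serves here: `2 / ε ≥ 3 > e`.
  have hL : 1 ≤ Real.log (2 / ε) := by
    rw [Real.le_log_iff_exp_le (by positivity), le_div_iff₀ hε]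
    nlinarith [Real.exp_one_lt_d9, Real.exp_pos 1]
  have hi : Integrable (B.clippedTerm ε k i) (B.roundLaw i) :=
    Integrable.of_mem_Icc 0 (2 * Real.log (2 / ε)) (B.measurable_clippedTerm ε k i).aemeasurable
      ((B.reward_mem_Icc i).mono fun z hz => clippedTerm_mem_Icc hM (by linarith) hz)
  have hyρ := integrable_reward_mul_ratio hac
  have hM0 : 0 < B.logDiv k i := by linarith
  constructor
  · have hlow : ∫ z, 1 / B.logDiv k i * (z.reward * B.ratio k i z -
        Real.exp (1 - 2 * Real.log (2 / ε) * B.logDiv k i) *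
          (B.ratio k i z * Real.exp (B.ratio k i z - 1))) ∂(B.roundLaw i) ≤
        ∫ z, B.clippedTerm ε k i z ∂(B.roundLaw i) := by
      refine integral_mono_ae ((hyρ.sub (hint.const_mul _)).const_mul _) hi ?_
      filter_upwards [B.reward_mem_Icc i] with z hz
      have hρ := B.ratio_nonneg k i z
      rw [clippedTerm_eq]
      refine mul_le_mul_of_nonneg_left ?_ (by positivity)
      split_ifs with hc
      · have : 0 ≤ Real.exp (1 - 2 * Real.log (2 / ε) * B.logDiv k i) *
          (B.ratio k i z * Real.exp (B.ratio k i z - 1)) := by positivity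
        linarith
      · rw [mul_zero, sub_nonpos, mul_left_comm, ← Real.exp_add, mul_comm]
        have h1 : (1 : ℝ) ≤ Real.exp (1 - 2 * Real.log (2 / ε) * B.logDiv k i +
            (B.ratio k i z - 1)) := Real.one_le_exp (by linarith [not_le.1 hc])
        exact mul_le_mul_of_nonneg_left (hz.2.trans h1) hρ
    refine le_trans ?_ hlow
    rw [integral_const_mul, integral_sub hyρ (hint.const_mul _), integral_const_mul,
      integral_reward_mul_ratio hac, hD, ← Real.exp_add]
    refine mul_le_mul_of_nonneg_left (sub_le_sub_left ?_ _) (by positivity)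
    -- With `L = log(2 / ε)`, the exponent is `M_{ki} - 2 L M_{ki} ≤ -L`, as `L` and `M_{ki}` are at
    -- least `1`.
    calc Real.exp (1 - 2 * Real.log (2 / ε) * B.logDiv k i + (B.logDiv k i - 1)) ≤
          Real.exp (-Real.log (2 / ε)) := Real.exp_le_exp.2 (by nlinarith)
      _ = ε / 2 := by
          rw [← Real.log_inv, Real.exp_log (by positivity), inv_div]
  · rw [← integral_reward_mul_ratio hac, ← integral_const_mul]
    refine integral_mono_ae hi (hyρ.const_mul _) ?_
    filter_upwards [B.reward_mem_Icc i] with z hz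
    have hρ := B.ratio_nonneg k i z
    have hz0 := hz.1
    rw [clippedTerm_eq]
    refine mul_le_mul_of_nonneg_left ?_ (by positivity)
    split_ifs
    · rw [mul_one]
    · rw [mul_zero]; positivity

/-! Deterministic consequences of concentration, for a realization of the interaction -/

/-- Every round counts for expert `k` with a weight between `1 / M` and `1`, whichever expert was
selected; this is the source of the sharing of information. -/
theorem clippedMass_bounds (hfin : ∀ i j, B.expDiv i j ≠ ⊤) (κ : ℕ → Fin N) (t : ℕ) (k : Fin N) :
    t / B.maxLogDiv ≤ B.clippedMass κ t k ∧ B.clippedMass κ t k ≤ t := by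
  unfold clippedMass
  constructor
  · have := Finset.card_nsmul_le_sum (Finset.Icc 1 t) (fun s => 1 / B.logDiv k (κ s))
      (1 / B.maxLogDiv) fun s _ => by
        have h1 := (expDiv_spec (hfin k (κ s))).2.1
        exact one_div_le_one_div_of_le (by linarith) (logDiv_le_maxLogDiv _ _)
    simpa [div_eq_mul_inv] using this
  · have := Finset.sum_le_card_nsmul (Finset.Icc 1 t) (fun s => 1 / B.logDiv k (κ s))
      1 fun s _ => by
        have h1 := (expDiv_spec (hfin k (κ s))).2.1
        exact div_le_one_of_le₀ h1 (by linarith)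
    simpa using this

theorem one_le_maxLogDiv (hfin : ∀ i j, B.expDiv i j ≠ ⊤) (k : Fin N) : 1 ≤ B.maxLogDiv :=
  (expDiv_spec (hfin k k)).2.1.trans (logDiv_le_maxLogDiv k k)

theorem clippedMass_pos (hfin : ∀ i j, B.expDiv i j ≠ ⊤) (κ : ℕ → Fin N) {t : ℕ} (ht : 2 ≤ t)
    (k : Fin N) : 0 < B.clippedMass κ t k := by
  have h1 := one_le_maxLogDiv hfin k
  have ht' : (0 : ℝ) < t := by positivity
  exact lt_of_lt_of_le (by positivity) (clippedMass_bounds hfin κ t k).1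

theorem clippedBeta_spec (hfin : ∀ i j, B.expDiv i j ≠ ⊤) (κ : ℕ → Fin N) {t : ℕ} (ht : 2 ≤ t)
    (k : Fin N) : 0 < B.clippedBeta κ t k ∧ B.clippedBeta κ t k < 2 ∧
      B.clippedBeta κ t k * B.clippedMass κ t k =
        4 * √(t * Real.log t) * Real.log (2 / B.clippedBeta κ t k) := by
  have ht' : (2 : ℝ) ≤ t := by exact_mod_cast ht
  have hlog : 0 < Real.log t := Real.log_pos (by linarith)
  have hZ := clippedMass_pos hfin κ ht k
  -- `Classical.epsilon` is a solution only once one exists; this needs `t ≥ 2`, for `log t > 0`.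
  have hex := exists_div_log_eq (c := √(16 * t * Real.log t) / B.clippedMass κ t k)
    (by positivity)
  obtain ⟨h1, h2, h3⟩ := Classical.epsilon_spec hex
  refine ⟨h1, h2, ?_⟩
  change B.clippedBeta κ t k / Real.log (2 / B.clippedBeta κ t k) = _ at h3
  have hL : 0 < Real.log (2 / B.clippedBeta κ t k) :=
    Real.log_pos ((one_lt_div h1).2 h2)
  have h16 : √(16 * t * Real.log t) = 4 * √(t * Real.log t) := by
    rw [mul_assoc, Real.sqrt_mul (by norm_num), show (16 : ℝ) = 4 ^ 2 by norm_num,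
      Real.sqrt_sq (by norm_num)]
  rw [div_eq_div_iff hL.ne' hZ.ne', h16] at h3
  exact h3

/-- The sum of the deviations of the clipped terms from their means. -/
noncomputable def clippedDev (B : ExpertBandit 𝒳 K N) (κ : ℕ → Fin N) (ξ : ℕ → BanditRound 𝒳 K)
    (t : ℕ) (ε : ℝ) (k : Fin N) : ℝ :=
  ∑ s ∈ Finset.Icc 1 t, (B.clippedTerm ε k (κ s) (ξ s) -
    ∫ z, B.clippedTerm ε k (κ s) z ∂(B.roundLaw (κ s)))

theorem sum_clippedTerm_bounds (hfin : ∀ i j, B.expDiv i j ≠ ⊤) (κ : ℕ → Fin N)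
    (ξ : ℕ → BanditRound 𝒳 K) (t : ℕ) {ε : ℝ} (hε : 0 < ε) (hε1 : ε ≤ 2 / 3) (k : Fin N) :
    B.clippedMass κ t k * (B.mean k - ε / 2) + B.clippedDev κ ξ t ε k ≤
        ∑ s ∈ Finset.Icc 1 t, B.clippedTerm ε k (κ s) (ξ s) ∧
      ∑ s ∈ Finset.Icc 1 t, B.clippedTerm ε k (κ s) (ξ s) ≤
        B.clippedMass κ t k * B.mean k + B.clippedDev κ ξ t ε k := by
  unfold clippedDev clippedMass
  rw [Finset.sum_mul, Finset.sum_mul, ← Finset.sum_add_distrib, ← Finset.sum_add_distrib]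
  constructor <;> refine Finset.sum_le_sum fun s _ => ?_
  · linarith [(integral_clippedTerm_mem_Icc hε hε1 (hfin k (κ s))).1]
  · linarith [(integral_clippedTerm_mem_Icc hε hε1 (hfin k (κ s))).2]

theorem clippedIndex_eq (κ : ℕ → Fin N) (ξ : ℕ → BanditRound 𝒳 K) (t : ℕ) (k : Fin N) :
    B.clippedIndex κ ξ t k = (∑ s ∈ Finset.Icc 1 t,
      B.clippedTerm (B.clippedBeta κ t k) k (κ s) (ξ s)) / B.clippedMass κ t k +
        3 / 2 * B.clippedBeta κ t k := by
  rw [clippedIndex, clippedEstimate, one_div_mul_eq_div]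
  rfl

/-- If the clipped sums concentrate for all clipping levels `(2 / 3) ^ (m + 1)`, then the index of
an expert is an upper confidence bound with width of order `β`. -/
theorem clippedIndex_bounds (hfin : ∀ i j, B.expDiv i j ≠ ⊤) {κ : ℕ → Fin N}
    {ξ : ℕ → BanditRound 𝒳 K} {t : ℕ} (ht : 2 ≤ t)
    (hξ : ∀ s, 1 ≤ s → (ξ s).reward ∈ Set.Icc (0 : ℝ) 1) {k : Fin N}
    (hdev : ∀ m ≤ t, |B.clippedDev κ ξ t ((2 / 3) ^ (m + 1)) k| ≤
      3 * √(t * Real.log t) * Real.log (2 / (2 / 3) ^ (m + 1))) :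
    B.mean k ≤ B.clippedIndex κ ξ t k ∧ (B.clippedIndex κ ξ t k ≤
      B.mean k + 3 * B.clippedBeta κ t k ∨ 2 / 3 ≤ B.clippedBeta κ t k) := by
  have ht' : (2 : ℝ) ≤ t := by exact_mod_cast ht
  have hlogt : 0 < Real.log t := Real.log_pos (by linarith)
  have hZ := clippedMass_pos hfin κ ht k
  have hZt := (clippedMass_bounds hfin κ t k).2
  obtain ⟨hβ0, hβ2, hβ⟩ := clippedBeta_spec hfin κ ht k
  rw [clippedIndex_eq]
  set β := B.clippedBeta κ t k with hβdef
  set Z := B.clippedMass κ t k with hZdef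
  set w := √(t * Real.log t) with hw
  have hM : ∀ s, 1 ≤ B.logDiv k (κ s) := fun s => (expDiv_spec (hfin k (κ s))).2.1
  -- Here the bonus alone is at least `1`, hence at least any mean.
  by_cases hbig : 2 / 3 ≤ β
  · refine ⟨?_, Or.inr hbig⟩
    have hS : 0 ≤ ∑ s ∈ Finset.Icc 1 t, B.clippedTerm β k (κ s) (ξ s) :=
      Finset.sum_nonneg fun s hs =>
        clippedTerm_nonneg (hM s) (hξ s (Finset.mem_Icc.1 hs).1).1
    have := (B.mean_mem_Icc k).2
    have : 0 ≤ (∑ s ∈ Finset.Icc 1 t, B.clippedTerm β k (κ s) (ξ s)) / Z := by positivity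
    linarith
  rw [not_le] at hbig
  -- The neighbouring grid levels: `(2 / 3) ^ (m + 2) ≤ β ≤ (2 / 3) ^ (m + 1) < 3 / 2 * β`.
  obtain ⟨m, hm1, hm2⟩ := exists_nat_pow_near_of_lt_one (x := 3 / 2 * β) (y := 2 / 3)
    (by positivity) (by linarith) (by norm_num) (by norm_num)
  have hεm : β ≤ (2 / 3) ^ (m + 1) := by rw [pow_succ]; linarith
  have hεm' : (2 / 3) ^ (m + 1) ≤ 3 / 2 * β := hm1.le
  have hεs : (2 / 3 : ℝ) ^ (m + 1 + 1) ≤ β := by rw [pow_succ]; linarith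
  have hε1 : ∀ n : ℕ, (2 / 3 : ℝ) ^ (n + 1) ≤ 2 / 3 := fun n =>
    pow_le_of_le_one (by norm_num) (by norm_num) (by omega)
  set L := Real.log (2 / β) with hL
  have hL1 : 1 ≤ L := by
    rw [hL, Real.le_log_iff_exp_le (by positivity), le_div_iff₀ hβ0]
    nlinarith [Real.exp_one_lt_d9, Real.exp_pos 1]
  have hw2 : w ^ 2 = t * Real.log t := Real.sq_sqrt (by positivity)
  have hw0 : 0 ≤ w := Real.sqrt_nonneg _
  -- Only the levels up to `t` are controlled. As the mass is at most `t`, the equation for `β`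
  -- gives `β² t ≥ 16 log t ≥ 1`, hence `(9 / 4) ^ (m + 1) ≤ t`.
  have hmt : m + 1 ≤ t := by
    have h1 : 4 * w ≤ β * t := by nlinarith
    have h2 : 16 * (t * Real.log t) ≤ β ^ 2 * t ^ 2 := by
      rw [← hw2, ← mul_pow]
      nlinarith
    have h3 : 1 ≤ β ^ 2 * t := by
      have hl2 : Real.log 2 ≤ Real.log t := Real.log_le_log (by norm_num) ht'
      have := Real.log_two_gt_d9
      by_contra! hlt
      nlinarith
    have h4 : β ^ 2 ≤ (4 / 9) ^ (m + 1) := by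
      calc β ^ 2 ≤ ((2 / 3) ^ (m + 1)) ^ 2 := pow_le_pow_left₀ hβ0.le hεm 2
        _ = (4 / 9) ^ (m + 1) := by rw [← pow_mul, mul_comm, pow_mul]; norm_num
    have h5 : (9 / 4 : ℝ) ^ (m + 1) ≤ t := by
      have h6 : (9 / 4 : ℝ) ^ (m + 1) * (4 / 9) ^ (m + 1) = 1 := by
        rw [← mul_pow]; norm_num
      have h7 : 1 ≤ (4 / 9 : ℝ) ^ (m + 1) * t :=
        h3.trans (mul_le_mul_of_nonneg_right h4 (by linarith))
      calc (9 / 4 : ℝ) ^ (m + 1) ≤ (9 / 4 : ℝ) ^ (m + 1) * ((4 / 9 : ℝ) ^ (m + 1) * t) :=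
            le_mul_of_one_le_right (by positivity) h7
        _ = t := by rw [← mul_assoc, h6, one_mul]
    have h8 := one_add_mul_le_pow (show (-2 : ℝ) ≤ 5 / 4 by norm_num) (m + 1)
    norm_num at h8
    have h9 : (m : ℝ) + 1 ≤ t := by nlinarith
    exact_mod_cast h9
  have hlow := (sum_clippedTerm_bounds hfin κ ξ t (by positivity) (hε1 m) k).1
  have hupp := (sum_clippedTerm_bounds hfin κ ξ t (by positivity) (hε1 (m + 1)) k).2
  have hd1 := (abs_le.1 (hdev m (by omega))).1
  have hd2 := (abs_le.1 (hdev (m + 1) hmt)).2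
  have hs1 : ∑ s ∈ Finset.Icc 1 t, B.clippedTerm ((2 / 3) ^ (m + 1)) k (κ s) (ξ s) ≤
      ∑ s ∈ Finset.Icc 1 t, B.clippedTerm β k (κ s) (ξ s) :=
    Finset.sum_le_sum fun s hs =>
      clippedTerm_anti hβ0 hεm (hM s) (hξ s (Finset.mem_Icc.1 hs).1).1
  have hs2 : ∑ s ∈ Finset.Icc 1 t, B.clippedTerm β k (κ s) (ξ s) ≤
      ∑ s ∈ Finset.Icc 1 t, B.clippedTerm ((2 / 3) ^ (m + 1 + 1)) k (κ s) (ξ s) :=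
    Finset.sum_le_sum fun s hs =>
      clippedTerm_anti (by positivity) hεs (hM s) (hξ s (Finset.mem_Icc.1 hs).1).1
  have hLm : Real.log (2 / (2 / 3) ^ (m + 1)) ≤ L :=
    Real.log_le_log (by positivity) (by gcongr)
  have hLs : Real.log (2 / (2 / 3) ^ (m + 1 + 1)) ≤ 2 * L := by
    have h1 : Real.log (2 / (2 / 3) ^ (m + 1 + 1)) ≤ Real.log (2 / β * (3 / 2)) := by
      refine Real.log_le_log (by positivity) ?_
      rw [pow_succ, div_mul_div_comm, div_le_div_iff₀ (by positivity) (by positivity)]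
      nlinarith
    rw [Real.log_mul (by positivity) (by norm_num)] at h1
    have h2 := Real.log_le_sub_one_of_pos (show (0 : ℝ) < 3 / 2 by norm_num)
    linarith
  have hwm := mul_le_mul_of_nonneg_left hLm (show 0 ≤ 3 * w by positivity)
  have hws := mul_le_mul_of_nonneg_left hLs (show 0 ≤ 3 * w by positivity)
  -- Since `β Z = 4 w L`, a deviation `3 w L` costs `3/4 β`. Below, this and the bias, at most `3/4
  -- β`, are exactly offset by the bonus `3/2 β`; above, the deviation is at most `6 w L`, that is
  -- `3/2 β`, and adds to the bonus.
  refine ⟨?_, Or.inl ?_⟩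
  · rw [← sub_le_iff_le_add, le_div_iff₀ hZ]
    nlinarith
  · rw [← le_sub_iff_add_le, div_le_iff₀ hZ]
    nlinarith

/-- Optimism gives a gap of at most `3 β`. If the gap is nonzero, then `Δ_(2) ≤ 3 β`, which bounds
`log(2 / β)` by `log(6 / Δ_(2))` and makes the implicit equation for `β` explicit. -/
theorem gap_le_of_clippedIndex_le (hfin : ∀ i j, B.expDiv i j ≠ ⊤) {κ : ℕ → Fin N}
    {ξ : ℕ → BanditRound 𝒳 K} {t : ℕ} (ht : 2 ≤ t)
    (hξ : ∀ s, 1 ≤ s → (ξ s).reward ∈ Set.Icc (0 : ℝ) 1)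
    (hdev : ∀ k, ∀ m ≤ t, |B.clippedDev κ ξ t ((2 / 3) ^ (m + 1)) k| ≤
      3 * √(t * Real.log t) * Real.log (2 / (2 / 3) ^ (m + 1)))
    (hN : 2 ≤ N) (hΔ : 0 < B.sortedGap 2) {i : Fin N}
    (hi : ∀ j, B.clippedIndex κ ξ t j ≤ B.clippedIndex κ ξ t i) {T : ℕ} (hT : t ≤ T) :
    B.gap i ≤ √((12 * B.maxLogDiv * Real.log (6 / B.sortedGap 2)) ^ 2 * Real.log T / t) := by
  rcases B.gap_eq_zero_or_le hN i with h0 | h0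
  · rw [h0]; positivity
  have ht' : (2 : ℝ) ≤ t := by exact_mod_cast ht
  have hlogt : 0 < Real.log t := Real.log_pos (by linarith)
  have hlogT : Real.log t ≤ Real.log T :=
    Real.log_le_log (by linarith) (by exact_mod_cast hT)
  obtain ⟨hβ0, hβ2, hβ⟩ := clippedBeta_spec hfin κ ht i
  have hZ := (clippedMass_bounds hfin κ t i).1
  have hM := one_le_maxLogDiv hfin i
  have hgap : B.gap i ≤ 3 * B.clippedBeta κ t i := by
    rcases (clippedIndex_bounds hfin ht hξ (hdev i)).2 with h | h
    · have : Nonempty (Fin N) := ⟨i⟩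
      obtain ⟨j, hj⟩ := exists_eq_ciSup_of_finite (f := B.mean)
      have h1 := (clippedIndex_bounds hfin ht hξ (hdev j)).1
      have h2 := hi j
      rw [gap, ← hj]
      linarith
    · linarith [B.gap_le_one i]
  set β := B.clippedBeta κ t i
  set w := √(t * Real.log t) with hw
  have hw0 : 0 ≤ w := Real.sqrt_nonneg _
  have hw2 : w ^ 2 = t * Real.log t := Real.sq_sqrt (by positivity)
  have hL : Real.log (2 / β) ≤ Real.log (6 / B.sortedGap 2) := by
    refine Real.log_le_log (by positivity) ?_
    rw [div_le_div_iff₀ hβ0 hΔ]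
    linarith
  have hL0 : 0 ≤ Real.log (6 / B.sortedGap 2) :=
    Real.log_nonneg ((one_le_div hΔ).2 (by linarith [B.sortedGap_two_le_one]))
  have h1 : β * t ≤ 4 * B.maxLogDiv * Real.log (6 / B.sortedGap 2) * w := by
    rw [div_le_iff₀ (by linarith)] at hZ
    have h2 : β * t ≤ β * B.clippedMass κ t i * B.maxLogDiv := by
      rw [mul_assoc]; exact mul_le_mul_of_nonneg_left hZ hβ0.le
    rw [hβ] at h2
    refine h2.trans ?_
    have := mul_le_mul_of_nonneg_left hL (show 0 ≤ 4 * w * B.maxLogDiv by positivity)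
    nlinarith
  refine hgap.trans (Real.le_sqrt_of_sq_le ?_)
  rw [le_div_iff₀ (by linarith)]
  have h3 : (3 * β) ^ 2 * t ^ 2 ≤
      (12 * B.maxLogDiv * Real.log (6 / B.sortedGap 2)) ^ 2 * (t * Real.log t) := by
    rw [← hw2, ← mul_pow, ← mul_pow]
    exact pow_le_pow_left₀ (by positivity) (by linarith) 2
  have h4 : (3 * β) ^ 2 * t ≤
      (12 * B.maxLogDiv * Real.log (6 / B.sortedGap 2)) ^ 2 * Real.log t := by
    refine le_of_mul_le_mul_right ?_ (show (0 : ℝ) < t by linarith)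
    linarith
  exact h4.trans (mul_le_mul_of_nonneg_left hlogT (sq_nonneg _))

variable {Ω : Type*} [mΩ : MeasurableSpace Ω] {P : Measure Ω}
  {ℱ : Filtration ℕ mΩ} {κ : ℕ → Ω → Fin N} {ξ : ℕ → Ω → BanditRound 𝒳 K}

theorem IsRun.measure_clippedDev_le [IsProbabilityMeasure P] (h : B.IsRun P ℱ κ ξ)
    (hfin : ∀ i j, B.expDiv i j ≠ ⊤) {t : ℕ} (ht : 2 ≤ t) :
    P {ω | ¬ ∀ k, ∀ m ≤ t,
      |B.clippedDev (fun s => κ s ω) (fun s => ξ s ω) t ((2 / 3) ^ (m + 1)) k| ≤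
        3 * √(t * Real.log t) * Real.log (2 / (2 / 3) ^ (m + 1))} ≤
      ENNReal.ofReal (4 * N / t ^ 2) := by
  have ht' : (2 : ℝ) ≤ t := by exact_mod_cast ht
  have hlogt : 0 < Real.log t := Real.log_pos (by linarith)
  have hone : ∀ k, ∀ m : ℕ, P {ω | 3 * √(t * Real.log t) * Real.log (2 / (2 / 3) ^ (m + 1)) ≤
      |B.clippedDev (fun s => κ s ω) (fun s => ξ s ω) t ((2 / 3) ^ (m + 1)) k|} ≤
      ENNReal.ofReal (2 / t ^ 3) := by
    intro k m
    have hL : 0 < Real.log (2 / (2 / 3) ^ (m + 1)) := by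
      refine Real.log_pos ((one_lt_div (by positivity)).2 ?_)
      exact (pow_le_one₀ (by norm_num) (by norm_num)).trans_lt (by norm_num)
    refine (h.measure_abs_sum_ge_le (φ := fun i z => B.clippedTerm ((2 / 3) ^ (m + 1)) k i z)
      (fun i => B.measurable_clippedTerm _ k i) (b := 2 * Real.log (2 / (2 / 3) ^ (m + 1)))
      (by positivity) (fun i => (B.reward_mem_Icc i).mono fun z hz =>
        clippedTerm_mem_Icc (expDiv_spec (hfin k i)).2.1 hL.le hz) (by omega : 0 < t)
      (by positivity)).trans (ENNReal.ofReal_le_ofReal ?_)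
    -- The logarithm of the level cancels, as both the range and the deviation are proportional to
    -- it. Each event has probability at most `2 / t³`, which leaves room for a union over `t + 1`
    -- levels.
    have he : 2 * (3 * √(t * Real.log t) * Real.log (2 / (2 / 3) ^ (m + 1))) ^ 2 /
        (t * (2 * Real.log (2 / (2 / 3) ^ (m + 1))) ^ 2) = 9 / 2 * Real.log t := by
      rw [mul_pow, mul_pow, Real.sq_sqrt (by positivity), mul_pow]
      field_simp
      norm_num
    rw [he, div_eq_mul_inv]
    refine mul_le_mul_of_nonneg_left ?_ (by norm_num)
    calc Real.exp (-(9 / 2 * Real.log t)) ≤ Real.exp (-(((3 : ℕ) : ℝ) * Real.log t)) :=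
          Real.exp_le_exp.2 (by push_cast; linarith)
      _ = ((t : ℝ) ^ 3)⁻¹ := by
          rw [Real.exp_neg, Real.exp_nat_mul, Real.exp_log (by linarith)]
  calc _ ≤ P (⋃ k, ⋃ m ∈ Finset.range (t + 1),
        {ω | 3 * √(t * Real.log t) * Real.log (2 / (2 / 3) ^ (m + 1)) ≤
          |B.clippedDev (fun s => κ s ω) (fun s => ξ s ω) t ((2 / 3) ^ (m + 1)) k|}) := by
        refine measure_mono fun ω hω => ?_
        simp only [Set.mem_ofPred_eq, not_forall, not_le] at hω
        obtain ⟨k, m, hm, hlt⟩ := hω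
        simp only [Set.mem_iUnion, Finset.mem_range]
        exact ⟨k, m, by omega, hlt.le⟩
    _ ≤ ∑ k : Fin N, ∑ m ∈ Finset.range (t + 1), ENNReal.ofReal (2 / t ^ 3) := by
        refine (measure_iUnion_fintype_le _ _).trans (Finset.sum_le_sum fun k _ => ?_)
        exact (measure_biUnion_finset_le _ _).trans (Finset.sum_le_sum fun m _ => hone k m)
    _ = ENNReal.ofReal (N * ((t + 1) * (2 / t ^ 3))) := by
        simp only [Finset.sum_const, Finset.card_univ, Fintype.card_fin, Finset.card_range,
          nsmul_eq_mul]
        rw [ENNReal.ofReal_mul (by positivity), ENNReal.ofReal_mul (by positivity),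
          ENNReal.ofReal_natCast]
        congr 2
        rw [← Nat.cast_succ, ENNReal.ofReal_natCast]
    _ ≤ ENNReal.ofReal (4 * N / t ^ 2) := by
        refine ENNReal.ofReal_le_ofReal ?_
        have h1 : ((t : ℝ) + 1) * (2 / t ^ 3) ≤ 4 / t ^ 2 := by
          rw [mul_div_assoc', div_le_div_iff₀ (by positivity) (by positivity)]
          have : 0 ≤ (t : ℝ) ^ 2 := by positivity
          nlinarith
        calc (N : ℝ) * ((t + 1) * (2 / t ^ 3)) ≤ N * (4 / t ^ 2) := by gcongr
          _ = _ := by ring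

theorem IsRun.regret_clipped_le [IsProbabilityMeasure P] (h : B.IsRun P ℱ κ ξ) (hN : 2 ≤ N)
    (hΔ : 0 < B.sortedGap 2) (hfin : ∀ i j, B.expDiv i j ≠ ⊤) (hucb : B.IsClippedUCB P κ ξ)
    (T : ℕ) :
    B.regret P κ T ≤ 3 + 8 * N + 2 * ((12 * B.maxLogDiv * Real.log (6 / B.sortedGap 2)) ^ 2 *
      Real.log T / B.sortedGap 2) := by
  have hreg := h.regret_le hN hΔ (t₀ := 2) (T := T) (c := 4 * N)
    (A := (12 * B.maxLogDiv * Real.log (6 / B.sortedGap 2)) ^ 2 * Real.log T)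
    (by positivity) (mul_nonneg (sq_nonneg _) (Real.log_natCast_nonneg T)) ?_
  · refine hreg.trans (le_of_eq ?_)
    push_cast
    ring
  · intro t _ ht htT
    refine (measure_mono_ae ?_).trans (h.measure_clippedDev_le hfin ht)
    filter_upwards [h.ae_reward_mem_Icc, hucb] with ω hω hu hbad hdev
    exact hbad (gap_le_of_clippedIndex_le hfin ht hω hdev hN hΔ (hu t ht) htT.le)

end ExpertBandit

/-! ### The median of means estimator -/

namespace ExpertBandit

variable {𝒳 : Type*} [MeasurableSpace 𝒳] {K N : ℕ} (B : ExpertBandit 𝒳 K N)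

/-- The centred and normalized contribution of a round with expert `i` to the importance sampling
estimate of `μ_k`. -/
noncomputable def momTerm (k i : Fin N) (z : BanditRound 𝒳 K) : ℝ :=
  1 / B.sigma k i * (z.reward * B.ratio k i z - B.mean k)

theorem measurable_momTerm (k i : Fin N) : Measurable (B.momTerm k i) := by
  unfold momTerm
  exact ((measurable_reward.mul (B.measurable_ratio k i)).sub_const _).const_mul _

variable {B}

/-- As `y² ≤ 1`, the second moment before normalization is at most `σ_{ki}² - μ_k²`; dividing by
`σ_{ki}` makes all rounds comparable. -/
theorem momTerm_moments {k i : Fin N} (h : B.chiSqDiv k i ≠ ⊤) :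
    Integrable (B.momTerm k i) (B.roundLaw i) ∧
      Integrable (fun z => B.momTerm k i z ^ 2) (B.roundLaw i) ∧
      ∫ z, B.momTerm k i z ∂(B.roundLaw i) = 0 ∧
      ∫ z, B.momTerm k i z ^ 2 ∂(B.roundLaw i) ≤ 1 := by
  obtain ⟨hac, hσ, hint, hD⟩ := chiSqDiv_spec h
  have hσ0 : 0 < B.sigma k i := by linarith
  have hyρ := integrable_reward_mul_ratio hac
  have hcent := hyρ.sub (integrable_const (B.mean k))
  have hdom : Integrable (fun z => B.ratio k i z ^ 2 -
      2 * B.mean k * (z.reward * B.ratio k i z) + B.mean k ^ 2) (B.roundLaw i) :=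
    (hint.sub (hyρ.const_mul _)).add (integrable_const _)
  have hle : ∀ᵐ z ∂(B.roundLaw i), (z.reward * B.ratio k i z - B.mean k) ^ 2 ≤
      B.ratio k i z ^ 2 - 2 * B.mean k * (z.reward * B.ratio k i z) + B.mean k ^ 2 := by
    filter_upwards [B.reward_mem_Icc i] with z hz
    have h1 : (z.reward * B.ratio k i z) ^ 2 ≤ B.ratio k i z ^ 2 := by
      rw [mul_pow]
      exact mul_le_of_le_one_left (sq_nonneg _) (pow_le_one₀ hz.1 hz.2)
    nlinarith
  have hsq : Integrable (fun z => (z.reward * B.ratio k i z - B.mean k) ^ 2) (B.roundLaw i) := by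
    refine hdom.mono' ?_ ?_
    · exact (((measurable_reward.mul (B.measurable_ratio k i)).sub_const _).pow_const
        2).aestronglyMeasurable
    · filter_upwards [hle] with z hz
      rwa [Real.norm_of_nonneg (sq_nonneg _)]
  refine ⟨hcent.const_mul _, ?_, ?_, ?_⟩
  · simp only [momTerm, mul_pow]
    exact hsq.const_mul _
  · simp only [momTerm]
    rw [integral_const_mul, integral_sub hyρ (integrable_const _), integral_reward_mul_ratio hac]
    simp
  · simp only [momTerm, mul_pow]
    rw [integral_const_mul, one_div, inv_pow, inv_mul_le_iff₀ (by positivity), mul_one, ← hD]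
    refine (integral_mono_ae hsq hdom hle).trans ?_
    have hsub : Integrable (fun z => B.ratio k i z ^ 2 -
        2 * B.mean k * (z.reward * B.ratio k i z)) (B.roundLaw i) := hint.sub (hyρ.const_mul _)
    rw [integral_add hsub (integrable_const _), integral_sub hint (hyρ.const_mul _), integral_const_mul, integral_reward_mul_ratio hac]
    simp only [integral_const, probReal_univ, one_smul]
    nlinarith [sq_nonneg (B.mean k)]

/-! Sizes of the groups -/

theorem sum_pulls (κ : ℕ → Fin N) (t : ℕ) : ∑ i, pulls κ t i = t := by
  have := Finset.card_eq_sum_card_fiberwise (f := κ) (s := Finset.Icc 1 t) (t := Finset.univ)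
    (fun _ _ => Finset.mem_coe.2 (Finset.mem_univ _))
  rw [Nat.card_Icc] at this
  unfold pulls
  omega

/-- Each floor loses at most `1` per expert, hence `N` in total. The upper bound follows by
subtracting the lower bounds of the other `l - 1` groups from `t`. -/
theorem card_group_bounds {κ : ℕ → Fin N} {g : ℕ → ℕ} {t l : ℕ} (hl : 0 < l)
    (hg : ∀ s ∈ Finset.Icc 1 t, g s < l)
    (hbal : ∀ r < l, ∀ i, pulls κ t i / l ≤ ((group g t r).filter fun s => κ s = i).card)
    {r : ℕ} (hr : r < l) :
    (t : ℝ) / l - N ≤ (group g t r).card ∧ ((group g t r).card : ℝ) ≤ t / l + l * N := by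
  have hl' : (0 : ℝ) < l := by exact_mod_cast hl
  have hlow : ∀ r < l, (t : ℝ) / l - N ≤ (group g t r).card := by
    intro r hr
    have h1 := Finset.card_eq_sum_card_fiberwise (f := κ) (s := group g t r) (t := Finset.univ)
      (fun _ _ => Finset.mem_coe.2 (Finset.mem_univ _))
    have h2 : ∀ i, (pulls κ t i : ℝ) / l - 1 ≤
        ((group g t r).filter fun s => κ s = i).card := by
      intro i
      have h3 : (pulls κ t i : ℝ) / l < (pulls κ t i / l : ℕ) + 1 := by
        rw [div_lt_iff₀ hl']
        have := Nat.lt_div_mul_add (a := pulls κ t i) hl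
        have h4 : pulls κ t i < (pulls κ t i / l + 1) * l := by rw [add_mul, one_mul]; omega
        exact_mod_cast h4
      have h5 : ((pulls κ t i / l : ℕ) : ℝ) ≤
          ((group g t r).filter fun s => κ s = i).card := by exact_mod_cast hbal r hr i
      linarith
    have h6 := Finset.sum_le_sum fun i (_ : i ∈ Finset.univ) => h2 i
    rw [Finset.sum_sub_distrib, ← Finset.sum_div, ← Nat.cast_sum, sum_pulls, ← Nat.cast_sum,
      ← h1] at h6
    simpa using h6
  refine ⟨hlow r hr, ?_⟩
  have h1 := Finset.card_eq_sum_card_fiberwise (f := g) (s := Finset.Icc 1 t)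
    (t := Finset.range l) (fun s hs => Finset.mem_coe.2 (Finset.mem_range.2 (hg s hs)))
  rw [Nat.card_Icc, add_tsub_cancel_right,
    ← Finset.add_sum_erase _ _ (Finset.mem_range.2 hr)] at h1
  have h2 : ((l : ℝ) - 1) * (t / l - N) ≤
      ∑ r' ∈ (Finset.range l).erase r, ((group g t r').card : ℝ) := by
    have := Finset.card_nsmul_le_sum ((Finset.range l).erase r)
      (fun r' => ((group g t r').card : ℝ)) (t / l - N) fun r' hr' =>
        hlow r' (Finset.mem_range.1 (Finset.mem_of_mem_erase hr'))
    rw [Finset.card_erase_of_mem (Finset.mem_range.2 hr), Finset.card_range, nsmul_eq_mul,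
      Nat.cast_sub hl] at this
    simpa using this
  have h3 : (t : ℝ) = (group g t r).card +
      ∑ r' ∈ (Finset.range l).erase r, ((group g t r').card : ℝ) := by exact_mod_cast h1
  have h4 : ((l : ℝ) - 1) * (t / l - N) = t - t / l - (l - 1) * N := by
    field_simp
  have h5 : (0 : ℝ) ≤ N := by positivity
  nlinarith

theorem one_le_maxSigma (hfin : ∀ i j, B.chiSqDiv i j ≠ ⊤) (k : Fin N) : 1 ≤ B.maxSigma :=
  (chiSqDiv_spec (hfin k k)).2.1.trans (sigma_le_maxSigma k k)

theorem card_div_le_groupMass (hfin : ∀ i j, B.chiSqDiv i j ≠ ⊤) (κ : ℕ → Fin N) (g : ℕ → ℕ)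
    (t r : ℕ) (k : Fin N) : (group g t r).card / B.maxSigma ≤ B.groupMass κ g t r k := by
  have := Finset.card_nsmul_le_sum (group g t r) (fun s => 1 / B.sigma k (κ s))
    (1 / B.maxSigma) fun s _ => by
      have h1 := (chiSqDiv_spec (hfin k (κ s))).2.1
      exact one_div_le_one_div_of_le (by linarith) (sigma_le_maxSigma _ _)
  simpa [div_eq_mul_inv, groupMass] using this

theorem groupMean_eq (κ : ℕ → Fin N) (ξ : ℕ → BanditRound 𝒳 K) (g : ℕ → ℕ) (t r : ℕ)
    (k : Fin N) (h : B.groupMass κ g t r k ≠ 0) :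
    B.groupMean κ ξ g t r k = B.mean k +
      (∑ s ∈ group g t r, B.momTerm k (κ s) (ξ s)) / B.groupMass κ g t r k := by
  have hsum : ∑ s ∈ group g t r, B.momTerm k (κ s) (ξ s) =
      ∑ s ∈ group g t r, 1 / B.sigma k (κ s) * (ξ s).reward * B.ratio k (κ s) (ξ s) -
        B.groupMass κ g t r k * B.mean k := by
    rw [groupMass, Finset.sum_mul, ← Finset.sum_sub_distrib]
    refine Finset.sum_congr rfl fun s _ => ?_
    unfold momTerm; ring
  rw [hsum, groupMean]
  field_simp
  ring

theorem log_one_div_momDelta (t : ℕ) : Real.log (1 / momDelta t) = 2 * Real.log t := by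
  rw [momDelta, one_div_one_div, Real.log_pow]; push_cast; ring

theorem numGroups_le (t : ℕ) : (numGroups t : ℝ) ≤ 16 * Real.log t := by
  have h0 := Real.log_natCast_nonneg t
  rw [numGroups, log_one_div_momDelta]
  exact (Nat.floor_le (by positivity)).trans (by linarith)

theorem lt_numGroups_add_one (t : ℕ) : 16 * Real.log t < numGroups t + 1 := by
  rw [numGroups, log_one_div_momDelta]
  have := Nat.lt_floor_add_one (8 * (2 * Real.log t))
  linarith

theorem numGroups_pos {t : ℕ} (ht : 2 ≤ t) : 0 < numGroups t := by
  have h1 : Real.log 2 ≤ Real.log t := Real.log_le_log (by norm_num) (by exact_mod_cast ht)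
  have h2 := lt_numGroups_add_one t
  have h3 := Real.log_two_gt_d9
  have : (0 : ℝ) < numGroups t := by linarith
  exact_mod_cast this

/-- There are `O(log t)` groups. Beyond a time depending only on `N`, the rounding errors in the
group sizes, at most `l N`, are thus within a twentieth of `t / l`. -/
theorem exists_forall_numGroups_sq_le (N : ℕ) :
    ∃ t₀ : ℕ, 2 ≤ t₀ ∧ ∀ t, t₀ ≤ t → 20 * (N : ℝ) * (numGroups t : ℝ) ^ 2 ≤ t := by
  have h := ((Real.isLittleO_pow_log_id_atTop (n := 2)).bound
    (show (0 : ℝ) < 1 / (20 * 256 * (N + 1)) by positivity))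
  obtain ⟨t₀, ht₀⟩ := eventually_atTop.1 (tendsto_natCast_atTop_atTop.eventually h)
  refine ⟨max t₀ 2, le_max_right _ _, fun t ht => ?_⟩
  have h1 := ht₀ t ((le_max_left _ _).trans ht)
  rw [Real.norm_of_nonneg (sq_nonneg _), id, Real.norm_of_nonneg (Nat.cast_nonneg _),
    div_mul_eq_mul_div, one_mul, le_div_iff₀ (by positivity)] at h1
  have h2 : (numGroups t : ℝ) ^ 2 ≤ (16 * Real.log t) ^ 2 :=
    pow_le_pow_left₀ (by positivity) (numGroups_le t) 2
  have h3 := mul_le_mul_of_nonneg_left h2 (show (0 : ℝ) ≤ 20 * N by positivity)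
  have h4 : 0 ≤ Real.log t ^ 2 := sq_nonneg _
  nlinarith

/-- The groups in which the deviation of the estimate of `μ_k` is large. -/
noncomputable def badGroups (B : ExpertBandit 𝒳 K N) (κ : ℕ → Fin N) (ξ : ℕ → BanditRound 𝒳 K)
    (g : ℕ → ℕ) (t : ℕ) (k : Fin N) : Finset ℕ :=
  (Finset.range (numGroups t)).filter fun r =>
    63 / 10 * ((t : ℝ) / numGroups t) ≤ (∑ s ∈ group g t r, B.momTerm k (κ s) (ξ s)) ^ 2

theorem momIndex_bounds (hfin : ∀ i j, B.chiSqDiv i j ≠ ⊤) {κ : ℕ → Fin N}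
    {ξ : ℕ → BanditRound 𝒳 K} {g : ℕ → ℕ} {t : ℕ} (hN : 2 ≤ N) (ht : 2 ≤ t)
    (hlarge : 20 * (N : ℝ) * (numGroups t : ℝ) ^ 2 ≤ t)
    (hcard : ∀ r < numGroups t, (t : ℝ) / numGroups t - N ≤ (group g t r).card) {k : Fin N}
    (hbad : 2 * (B.badGroups κ ξ g t k).card < numGroups t) :
    B.mean k ≤ B.momIndex κ ξ g t k ∧
      B.momIndex κ ξ g t k ≤ B.mean k + 2 * (B.maxSigma * √(128 * Real.log t / t)) := by
  have hl := numGroups_pos ht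
  have hl' : (1 : ℝ) ≤ numGroups t := by exact_mod_cast hl
  have hle := numGroups_le t
  have ht' : (0 : ℝ) < t := by positivity
  have hN' : (2 : ℝ) ≤ N := by exact_mod_cast hN
  have : Nonempty (Fin (numGroups t)) := ⟨⟨0, hl⟩⟩
  have hσ := one_le_maxSigma hfin k
  have hlog0 : 0 ≤ Real.log t := Real.log_natCast_nonneg t
  have hq : √(64 * Real.log (1 / momDelta t) / t) = √(128 * Real.log t / t) := by
    rw [log_one_div_momDelta]; ring_nf
  unfold momIndex
  rw [hq]
  set q := √(128 * Real.log t / t) with hqdef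
  set u := (t : ℝ) / numGroups t with hu
  have hq0 : 0 ≤ q := Real.sqrt_nonneg _
  have hu20 : 20 * N * numGroups t ≤ u := by
    rw [hu, le_div_iff₀ (by linarith)]; linarith
  have huN : 20 * (N : ℝ) ≤ u := by nlinarith
  -- From `l(t) ≤ 16 log t` and `q² u = 128 log t / l(t)`.
  have hq2 : 8 ≤ q ^ 2 * u := by
    rw [hqdef, Real.sq_sqrt (by positivity), hu, div_mul_div_comm, le_div_iff₀ (by positivity)]
    nlinarith
  have hn : ∀ r < numGroups t, 19 / 20 * u ≤ (group g t r).card := fun r hr => by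
    linarith [hcard r hr]
  have hnpos : ∀ r < numGroups t, (0 : ℝ) < (group g t r).card := fun r hr => by
    linarith [hn r hr]
  have hmass : ∀ r : Fin (numGroups t), 1 / B.maxSigma ≤
      B.groupMass κ g t r k / (group g t r).card := by
    intro r
    rw [le_div_iff₀ (hnpos r r.2), one_div_mul_eq_div]
    exact card_div_le_groupMass hfin κ g t r k
  have hW : 1 / B.maxSigma ≤ B.momMass κ g t k := le_ciInf hmass
  have hW0 : 0 < B.momMass κ g t k := lt_of_lt_of_le (by positivity) hW
  have hwidth : 1 / B.momMass κ g t k * q ≤ B.maxSigma * q := by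
    refine mul_le_mul_of_nonneg_right ?_ hq0
    rwa [one_div_le hW0 (by linarith)]
  have hmed : realMedian (fun r : Fin (numGroups t) => B.groupMean κ ξ g t r k) ∈
      Set.Icc (B.mean k - 1 / B.momMass κ g t k * q) (B.mean k + 1 / B.momMass κ g t k * q) := by
    refine realMedian_mem_Icc _
      (Finset.univ.filter fun r : Fin (numGroups t) => (r : ℕ) ∈ B.badGroups κ ξ g t k) ?_ ?_
    · intro r hr
      have hrb : (r : ℕ) ∉ B.badGroups κ ξ g t k := fun h =>
        hr (Finset.mem_filter.2 ⟨Finset.mem_univ _, h⟩)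
      simp only [badGroups, Finset.mem_filter, Finset.mem_range, r.2, true_and, not_le] at hrb
      have hn0 := hnpos r r.2
      have hGM : 0 < B.groupMass κ g t r k := by
        have := hmass r
        rw [le_div_iff₀ hn0] at this
        exact lt_of_lt_of_le (by positivity) this
      rw [groupMean_eq κ ξ g t r k hGM.ne']
      set D := ∑ s ∈ group g t r, B.momTerm k (κ s) (ξ s)
      -- In a good group `D² < 6.3 u`, while `(n q)² ≥ (19/20)² u² q² ≥ 7.22 u`.
      have hD : |D| ≤ (group g t r).card * q := by
        refine abs_le_of_sq_le_sq ?_ (by positivity)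
        have h1 : (19 / 20 * u) ^ 2 ≤ ((group g t r).card : ℝ) ^ 2 :=
          pow_le_pow_left₀ (by positivity) (hn r r.2) 2
        rw [mul_pow]
        have h2 := mul_le_mul_of_nonneg_right h1 (sq_nonneg q)
        have h3 := mul_le_mul_of_nonneg_left hq2 (show 0 ≤ u by positivity)
        nlinarith
      have hWr : B.momMass κ g t k ≤ B.groupMass κ g t r k / (group g t r).card :=
        ciInf_le (Set.finite_range _).bddBelow r
      have hdiv : |D / B.groupMass κ g t r k| ≤ 1 / B.momMass κ g t k * q := by
        rw [abs_div, abs_of_pos hGM, div_le_iff₀ hGM, one_div_mul_eq_div, div_mul_eq_mul_div,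
          le_div_iff₀ hW0]
        rw [le_div_iff₀ hn0] at hWr
        calc |D| * B.momMass κ g t k ≤ (group g t r).card * q * B.momMass κ g t k :=
              mul_le_mul_of_nonneg_right hD hW0.le
          _ ≤ q * B.groupMass κ g t r k := by
              have := mul_le_mul_of_nonneg_left hWr hq0
              linarith
      obtain ⟨h1, h2⟩ := abs_le.1 hdiv
      constructor <;> linarith
    · refine lt_of_le_of_lt (Nat.mul_le_mul_left 2 ?_) hbad
      refine Finset.card_le_card_of_injOn (fun r : Fin (numGroups t) => (r : ℕ)) ?_
        Fin.val_injective.injOn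
      intro r hr
      exact (Finset.mem_filter.1 hr).2
  constructor <;> linarith [hmed.1, hmed.2]

theorem gap_le_of_momIndex_le (hfin : ∀ i j, B.chiSqDiv i j ≠ ⊤) {κ : ℕ → Fin N}
    {ξ : ℕ → BanditRound 𝒳 K} {g : ℕ → ℕ} {t : ℕ} (hN : 2 ≤ N) (ht : 2 ≤ t)
    (hlarge : 20 * (N : ℝ) * (numGroups t : ℝ) ^ 2 ≤ t)
    (hcard : ∀ r < numGroups t, (t : ℝ) / numGroups t - N ≤ (group g t r).card)
    (hbad : ∀ k, 2 * (B.badGroups κ ξ g t k).card < numGroups t) {i : Fin N}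
    (hi : ∀ j, B.momIndex κ ξ g t j ≤ B.momIndex κ ξ g t i) {T : ℕ} (hT : t ≤ T) :
    B.gap i ≤ √(512 * B.maxSigma ^ 2 * Real.log T / t) := by
  have ht' : (2 : ℝ) ≤ t := by exact_mod_cast ht
  have hlogt : 0 < Real.log t := Real.log_pos (by linarith)
  have hlogT : Real.log t ≤ Real.log T :=
    Real.log_le_log (by linarith) (by exact_mod_cast hT)
  have hσ := one_le_maxSigma hfin i
  have : Nonempty (Fin N) := ⟨i⟩
  obtain ⟨j, hj⟩ := exists_eq_ciSup_of_finite (f := B.mean)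
  have h1 := (momIndex_bounds hfin hN ht hlarge hcard (hbad j)).1
  have h2 := hi j
  have h3 := (momIndex_bounds hfin hN ht hlarge hcard (hbad i)).2
  have h4 : B.gap i ≤ 2 * (B.maxSigma * √(128 * Real.log t / t)) := by
    rw [gap, ← hj]; linarith
  refine h4.trans (Real.le_sqrt_of_sq_le ?_)
  rw [mul_pow, mul_pow, Real.sq_sqrt (by positivity), mul_div_assoc', mul_div_assoc',
    div_le_div_iff_of_pos_right (by linarith)]
  nlinarith [mul_le_mul_of_nonneg_left hlogT (sq_nonneg B.maxSigma)]

variable {Ω : Type*} [mΩ : MeasurableSpace Ω] {P : Measure Ω}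
  {ℱ : Filtration ℕ mΩ} {κ : ℕ → Ω → Fin N} {ξ : ℕ → Ω → BanditRound 𝒳 K} {G : ℕ → ℕ → Ω → ℕ}

/-- The union bound over sets of half the groups: at most `2 ^ l` sets against `6 ^ (-l/2)` leaves
`(2 / 3) ^ (l/2)`, and `l` is about `16 log t`. -/
theorem two_pow_mul_le {t : ℕ} (ht : 2 ≤ t) :
    (2 : ℝ) ^ numGroups t * (1 / 6) ^ ((numGroups t + 1) / 2) ≤ 3 / t ^ 2 := by
  set l := numGroups t with hl
  set m := (l + 1) / 2 with hm
  have ht' : (2 : ℝ) ≤ t := by exact_mod_cast ht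
  have hlm : l ≤ 2 * m := by omega
  have h1 : 16 * Real.log t < l + 1 := lt_numGroups_add_one t
  have h2 : (l : ℝ) ≤ 2 * m := by exact_mod_cast hlm
  have hlog : Real.log 2 ≤ Real.log t := Real.log_le_log (by norm_num) ht'
  have h3 := Real.log_two_gt_d9
  calc (2 : ℝ) ^ l * (1 / 6) ^ m ≤ 2 ^ (2 * m) * (1 / 6) ^ m := by
        gcongr
        norm_num
    _ = (2 / 3) ^ m := by rw [pow_mul, ← mul_pow]; norm_num
    _ ≤ Real.exp (-(1 / 3)) ^ m := by
        refine pow_le_pow_left₀ (by norm_num) ?_ m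
        have := Real.add_one_le_exp (-(1 / 3) : ℝ)
        linarith
    _ = Real.exp (m * -(1 / 3)) := (Real.exp_nat_mul _ _).symm
    _ ≤ Real.exp (1 + -(((2 : ℕ) : ℝ) * Real.log t)) := by
        refine Real.exp_le_exp.2 ?_
        push_cast
        linarith
    _ = Real.exp 1 / t ^ 2 := by
        rw [Real.exp_add, Real.exp_neg, Real.exp_nat_mul, Real.exp_log (by linarith),
          div_eq_mul_inv]
    _ ≤ 3 / t ^ 2 := by
        gcongr
        linarith [Real.exp_one_lt_d9]

theorem IsRun.measure_badGroups_le [IsProbabilityMeasure P] (h : B.IsRun P ℱ κ ξ)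
    (hG : IsGrouping ℱ κ G) (hfin : ∀ i j, B.chiSqDiv i j ≠ ⊤) {t : ℕ} (hN : 2 ≤ N) (ht : 2 ≤ t)
    (hlarge : 20 * (N : ℝ) * (numGroups t : ℝ) ^ 2 ≤ t) :
    P {ω | ¬ ∀ k, 2 * (B.badGroups (fun s => κ s ω) (fun s => ξ s ω) (fun s => G t s ω)
      t k).card < numGroups t} ≤ ENNReal.ofReal (3 * N / t ^ 2) := by
  have hl := numGroups_pos ht
  have hl' : (1 : ℝ) ≤ numGroups t := by exact_mod_cast hl
  have ht' : (0 : ℝ) < t := by positivity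
  set u := (t : ℝ) / numGroups t with hu
  have hu0 : 0 < u := by positivity
  have hu20 : 20 * N * numGroups t ≤ u := by
    rw [hu, le_div_iff₀ (by linarith)]; linarith
  -- The constant `63/10` defining bad groups is six times this `21/20`, so each bad group
  -- contributes a factor `1/6`.
  have hcard : ∀ ω, ∀ r < numGroups t,
      ((group (fun s => G t s ω) t r).card : ℝ) ≤ 21 / 20 * u := by
    intro ω r hr
    have := (card_group_bounds hl (fun s hs => hG.lt_numGroups t ht s hs ω)
      (fun r hr i => hG.balanced t ht ω r hr i) hr).2
    linarith
  set m := (numGroups t + 1) / 2 with hm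
  have hR : ∀ k, ∀ R ∈ (Finset.range (numGroups t)).powersetCard m,
      P {ω | ∀ r ∈ R, 63 / 10 * u ≤ (∑ s ∈ group (fun s => G t s ω) t r,
        B.momTerm k (κ s ω) (ξ s ω)) ^ 2} ≤ ENNReal.ofReal ((1 / 6) ^ m) := by
    intro k R hR
    rw [Finset.mem_powersetCard] at hR
    have := h.measure_forall_group_le (g := G t) (hG.measurable_group t)
      (φ := fun i z => B.momTerm k i z) (fun i => B.measurable_momTerm k i)
      (fun i => (momTerm_moments (hfin k i)).1) (fun i => (momTerm_moments (hfin k i)).2.1)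
      (fun i => (momTerm_moments (hfin k i)).2.2.1) (fun i => (momTerm_moments (hfin k i)).2.2.2)
      R (b := 21 / 20 * u) (θ := 63 / 10 * u) (by positivity) (by positivity) (n := t)
      (fun ω r hr => hcard ω r (Finset.mem_range.1 (hR.1 hr)))
    rw [hR.2, mul_div_mul_right _ _ hu0.ne'] at this
    norm_num at this ⊢
    exact this
  calc _ ≤ P (⋃ k, ⋃ R ∈ (Finset.range (numGroups t)).powersetCard m,
        {ω | ∀ r ∈ R, 63 / 10 * u ≤ (∑ s ∈ group (fun s => G t s ω) t r,
          B.momTerm k (κ s ω) (ξ s ω)) ^ 2}) := by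
        refine measure_mono fun ω hω => ?_
        simp only [Set.mem_ofPred_eq, not_forall, not_lt] at hω
        obtain ⟨k, hk⟩ := hω
        obtain ⟨R, hRsub, hRcard⟩ := Finset.exists_subset_card_eq
          (show m ≤ (B.badGroups (fun s => κ s ω) (fun s => ξ s ω) (fun s => G t s ω)
            t k).card by omega)
        simp only [Set.mem_iUnion]
        refine ⟨k, R, Finset.mem_powersetCard.2
          ⟨hRsub.trans (Finset.filter_subset _ _), hRcard⟩, fun r hr => ?_⟩
        exact (Finset.mem_filter.1 (hRsub hr)).2
    _ ≤ ∑ k : Fin N, ∑ R ∈ (Finset.range (numGroups t)).powersetCard m,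
          ENNReal.ofReal ((1 / 6) ^ m) := by
        refine (measure_iUnion_fintype_le _ _).trans (Finset.sum_le_sum fun k _ => ?_)
        exact (measure_biUnion_finset_le _ _).trans (Finset.sum_le_sum fun R hRm => hR k R hRm)
    _ = ENNReal.ofReal (N * ((numGroups t).choose m * (1 / 6) ^ m)) := by
        simp only [Finset.sum_const, Finset.card_univ, Fintype.card_fin, Finset.card_powersetCard,
          Finset.card_range, nsmul_eq_mul]
        rw [ENNReal.ofReal_mul (by positivity), ENNReal.ofReal_mul (by positivity),
          ENNReal.ofReal_natCast, ENNReal.ofReal_natCast]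
    _ ≤ ENNReal.ofReal (3 * N / t ^ 2) := by
        refine ENNReal.ofReal_le_ofReal ?_
        have hch : ((numGroups t).choose m : ℝ) ≤ 2 ^ numGroups t := by
          exact_mod_cast Nat.choose_le_two_pow _ _
        calc (N : ℝ) * ((numGroups t).choose m * (1 / 6) ^ m) ≤
              N * (2 ^ numGroups t * (1 / 6) ^ m) := by gcongr
          _ ≤ N * (3 / t ^ 2) := by gcongr; exact two_pow_mul_le ht
          _ = _ := by ring

theorem IsRun.regret_mom_le [IsProbabilityMeasure P] (h : B.IsRun P ℱ κ ξ) (hN : 2 ≤ N)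
    (hΔ : 0 < B.sortedGap 2) (hfin : ∀ i j, B.chiSqDiv i j ≠ ⊤) (hG : IsGrouping ℱ κ G)
    (hucb : B.IsMomUCB P κ ξ G) {t₀ : ℕ} (ht₀ : 2 ≤ t₀)
    (hlarge : ∀ t, t₀ ≤ t → 20 * (N : ℝ) * (numGroups t : ℝ) ^ 2 ≤ t) (T : ℕ) :
    B.regret P κ T ≤ t₀ + 1 + 6 * N +
      2 * (512 * B.maxSigma ^ 2 * Real.log T / B.sortedGap 2) := by
  have hreg := h.regret_le hN hΔ (t₀ := t₀) (T := T) (c := 3 * N)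
    (A := 512 * B.maxSigma ^ 2 * Real.log T)
    (by positivity) (mul_nonneg (by positivity) (Real.log_natCast_nonneg T)) ?_
  · refine hreg.trans (le_of_eq ?_)
    ring
  · intro t _ ht htT
    have ht2 : 2 ≤ t := ht₀.trans ht
    refine (measure_mono_ae ?_).trans (h.measure_badGroups_le hG hfin hN ht2 (hlarge t ht))
    filter_upwards [hucb] with ω hu hbad hgood
    have hl := numGroups_pos ht2
    have hl' : (1 : ℝ) ≤ numGroups t := by exact_mod_cast hl
    have hcard : ∀ r < numGroups t,
        (t : ℝ) / numGroups t - N ≤ (group (fun s => G t s ω) t r).card := fun r hr =>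
      (card_group_bounds hl (fun s hs => hG.lt_numGroups t ht2 s hs ω)
        (fun r hr i => hG.balanced t ht2 ω r hr i) hr).1
    -- Non-empty groups are needed for the selection rule to be in force.
    have hne : ∀ r < numGroups t, (group (fun s => G t s ω) t r).Nonempty := by
      intro r hr
      have h1 := hcard r hr
      have h2 : (20 : ℝ) * N ≤ t / numGroups t := by
        rw [le_div_iff₀ (by linarith)]
        have := hlarge t ht
        have h3 : (0 : ℝ) ≤ 20 * N * numGroups t := by positivity
        nlinarith
      have h4 : (2 : ℝ) ≤ N := by exact_mod_cast hN
      have h5 : (0 : ℝ) < (group (fun s => G t s ω) t r).card := by linarith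
      exact Finset.card_pos.1 (by exact_mod_cast h5)
    exact hbad (gap_le_of_momIndex_le hfin hN ht2 (hlarge t ht) hcard hgood (hu t ht2 hne) htT.le)

end ExpertBandit

/-! ### The regret bounds -/

theorem corollary1 :
    -- (i) the clipped estimator
    (∃ C : ℝ, 0 < C ∧ ∀ N : ℕ, 2 ≤ N → ∃ T₀ : ℕ,
      ∀ (K : ℕ) (𝒳 : Type*) [MeasurableSpace 𝒳] (B : ExpertBandit 𝒳 K N)
        (Ω : Type*) [mΩ : MeasurableSpace Ω] (P : Measure Ω) [IsProbabilityMeasure P]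
        (ℱ : Filtration ℕ mΩ) (κ : ℕ → Ω → Fin N) (ξ : ℕ → Ω → BanditRound 𝒳 K),
        0 < B.sortedGap 2 →
        (∀ i j, B.expDiv i j ≠ ⊤) →
        B.IsRun P ℱ κ ξ →
        B.IsClippedUCB P κ ξ →
        ∀ T : ℕ, T₀ ≤ T →
          B.regret P κ T ≤
            C * (B.maxLogDiv ^ 2 * Real.log (6 / B.sortedGap 2) ^ 2 * Real.log T / B.sortedGap 2 *
              min B.gapSum (1 / B.sortedGap 2))) ∧
    -- (ii) the median of means estimator
    (∃ C : ℝ, 0 < C ∧ ∀ N : ℕ, 2 ≤ N → ∃ T₀ : ℕ,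
      ∀ (K : ℕ) (𝒳 : Type*) [MeasurableSpace 𝒳] (B : ExpertBandit 𝒳 K N)
        (Ω : Type*) [mΩ : MeasurableSpace Ω] (P : Measure Ω) [IsProbabilityMeasure P]
        (ℱ : Filtration ℕ mΩ) (κ : ℕ → Ω → Fin N) (ξ : ℕ → Ω → BanditRound 𝒳 K)
        (G : ℕ → ℕ → Ω → ℕ),
        0 < B.sortedGap 2 →
        (∀ i j, B.chiSqDiv i j ≠ ⊤) →
        B.IsRun P ℱ κ ξ →
        ExpertBandit.IsGrouping ℱ κ G →
        B.IsMomUCB P κ ξ G →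
        ∀ T : ℕ, T₀ ≤ T →
          B.regret P κ T ≤
            C * (B.maxSigma ^ 2 * Real.log T / B.sortedGap 2 *
              min B.gapSum (1 / B.sortedGap 2))) := by
  -- The additive term `a ≤ L = log T` is absorbed into `A L / Δ`, because `A ≥ 1 ≥ 1 / m` and `Δ ≤
  -- 1`.
  have hfinal : ∀ {a C A m Δ L : ℝ}, 0 ≤ C → 1 ≤ A → 0 < Δ → Δ ≤ 1 → 1 ≤ m → 0 ≤ a → a ≤ L →
      a + C * (A * L / Δ) ≤ (1 + C) * (A * L / Δ * m) := by
    intro a C A m Δ L hC hA hΔ hΔ1 hm ha haL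
    have h1 : L ≤ A * L / Δ := by
      rw [le_div_iff₀ hΔ]
      nlinarith
    have h2 : A * L / Δ ≤ A * L / Δ * m := le_mul_of_one_le_right (by linarith) hm
    have h3 := mul_le_mul_of_nonneg_left h2 hC
    linarith
  have hlarge : ∀ a : ℝ, ∃ T₀ : ℕ, ∀ T : ℕ, T₀ ≤ T → a ≤ Real.log T := fun a =>
    eventually_atTop.1 ((Real.tendsto_log_atTop.comp tendsto_natCast_atTop_atTop).eventually_ge_atTop a)
  -- `288 = 2 · 12²` and `1024 = 2 · 512` come from the two regret bounds; the `1` pays for the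
  -- additive constants.
  refine ⟨⟨1 + 288, by norm_num, fun N hN => ?_⟩, ⟨1 + 1024, by norm_num, fun N hN => ?_⟩⟩
  · obtain ⟨T₀, hT₀⟩ := hlarge (3 + 8 * N)
    refine ⟨T₀, fun K 𝒳 _ B Ω _ P _ ℱ κ ξ hΔ hfin hrun hucb T hT => ?_⟩
    have hΔ1 := B.sortedGap_two_le_one
    have hM := ExpertBandit.one_le_maxLogDiv hfin ⟨0, by omega⟩
    have hL : 1 ≤ Real.log (6 / B.sortedGap 2) := by
      rw [Real.le_log_iff_exp_le (by positivity), le_div_iff₀ hΔ]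
      nlinarith [Real.exp_one_lt_d9, Real.exp_pos 1]
    refine (hrun.regret_clipped_le hN hΔ hfin hucb T).trans (le_trans (le_of_eq ?_)
      (hfinal (a := 3 + 8 * N) (C := 288)
        (A := B.maxLogDiv ^ 2 * Real.log (6 / B.sortedGap 2) ^ 2) (by norm_num)
        (one_le_mul_of_one_le_of_one_le (one_le_pow₀ hM) (one_le_pow₀ hL)) hΔ hΔ1
        (B.one_le_min_gapSum hΔ) (by positivity) (hT₀ T hT)))
    ring
  · obtain ⟨t₀, ht₀, hnum⟩ := ExpertBandit.exists_forall_numGroups_sq_le N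
    obtain ⟨T₀, hT₀⟩ := hlarge (t₀ + 1 + 6 * N)
    refine ⟨T₀, fun K 𝒳 _ B Ω _ P _ ℱ κ ξ G hΔ hfin hrun hG hucb T hT => ?_⟩
    have hσ := ExpertBandit.one_le_maxSigma hfin ⟨0, by omega⟩
    refine (hrun.regret_mom_le hN hΔ hfin hG hucb ht₀ hnum T).trans (le_trans (le_of_eq ?_)
      (hfinal (a := t₀ + 1 + 6 * N) (C := 1024) (A := B.maxSigma ^ 2) (by norm_num)
        (one_le_pow₀ hσ) hΔ B.sortedGap_two_le_one
        (B.one_le_min_gapSum hΔ) (by positivity) (hT₀ T hT)))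
    ring
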